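/- All graphs are finite and undirected; they may have multiple edges but no loops, and the graph with no vertices is allowed. A perfect matching of a graph $G$ is a set $M$ of edges of $G$ such that every vertex of $G$ is an end vertex of exactly one member of $M$. For an integer $k\ge 1$, a graph is called $k$-matchable if it has at least $k$ distinct perfect matchings, and minimally $k$-matchable if it is $k$-matchable but, for every edge $e$ of $G$, the graph $G-e$ is not. An odd subdivision of a graph $H$ is any graph obtained from $H$ by replacing every edge $e$ by a path of odd length (possibly $1$) connecting the end vertices of $e$, such that all these paths are pairwise internally disjoint and their internal vertices are new. **Theorem.** For every $k\ge 1$ there exists a finite set of graphs $\mathfrak{G}_k$ such that a graph is minimally $k$-matchable if and only if it is isomorphic to the disjoint union of an odd subdivision of some graph from $\mathfrak{G}_k$ and some number (possibly $0$) of copies of $K_2$. -/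

import Mathlib

/-!
Graphs are multigraphs `Graph α β` with vertices in `α` and edges in `β`; parallel edges are
distinct edges with the same ends.
-/

namespace Graph

universe u v u' v'

/-- A finite multigraph without loops. -/
structure IsFiniteLoopless {α : Type u} {β : Type v} (G : Graph α β) : Prop where
  finite_vertexSet : G.vertexSet.Finite
  finite_edgeSet : G.edgeSet.Finite
  loopless : G.Loopless

/-- A set of edges such that every vertex is an end of exactly one of its members. -/
def IsPerfectMatching {α : Type u} {β : Type v} (G : Graph α β) (M : Set β) : Prop :=
  M ⊆ G.edgeSet ∧ ∀ x ∈ G.vertexSet, ∃! e, e ∈ M ∧ G.Inc e x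

/-- The set of perfect matchings of `G`. -/
def perfectMatchings {α : Type u} {β : Type v} (G : Graph α β) : Set (Set β) :=
  {M | G.IsPerfectMatching M}

/-- `G` has at least `k` distinct perfect matchings. -/
def IsMatchable {α : Type u} {β : Type v} (k : ℕ) (G : Graph α β) : Prop :=
  (k : ℕ∞) ≤ G.perfectMatchings.encard

/-- `G` has at least `k` perfect matchings, but deleting any edge leaves fewer than `k`. -/
def IsMinimallyMatchable {α : Type u} {β : Type v} (k : ℕ) (G : Graph α β) : Prop :=
  G.IsMatchable k ∧ ∀ e ∈ G.edgeSet, ¬ (G.deleteEdges {e}).IsMatchable k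

/-- An isomorphism of multigraphs: bijections of the vertices and of the edges that preserve
incidence in both directions. -/
structure Isomorphism {α : Type u} {β : Type v} {α' : Type u'} {β' : Type v'}
    (G : Graph α β) (G' : Graph α' β') where
  vertexEquiv : G.vertexSet ≃ G'.vertexSet
  edgeEquiv : G.edgeSet ≃ G'.edgeSet
  isLink_iff : ∀ (e : G.edgeSet) (x y : G.vertexSet),
    G.IsLink e x y ↔ G'.IsLink (edgeEquiv e) (vertexEquiv x) (vertexEquiv y)

/-- The disjoint union of two multigraphs. -/
def disjointUnion {α : Type u} {β : Type v} {α' : Type u'} {β' : Type v'}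
    (G : Graph α β) (G' : Graph α' β') : Graph (α ⊕ α') (β ⊕ β') where
  vertexSet := Sum.inl '' G.vertexSet ∪ Sum.inr '' G'.vertexSet
  edgeSet := Sum.inl '' G.edgeSet ∪ Sum.inr '' G'.edgeSet
  IsLink
    | .inl e, .inl x, .inl y => G.IsLink e x y
    | .inr e, .inr x, .inr y => G'.IsLink e x y
    | _, _, _ => False
  isLink_symm := by
    rintro (e | e) _ <;> refine ⟨?_⟩ <;> rintro (x | x) (y | y) h <;>
      first | exact h.elim | exact IsLink.symm h
  eq_or_eq_of_isLink_of_isLink := by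
    rintro (e | e) (x | x) (y | y) (z | z) (w | w) h h' <;>
      first
        | exact h.elim
        | exact h'.elim
        | exact (IsLink.left_eq_or_eq h h').imp (congrArg _) (congrArg _)
  edge_mem_iff_exists_isLink := by
    rintro (e | e) <;> simp [edge_mem_iff_exists_isLink]
  left_mem_of_isLink := by
    rintro (e | e) (x | x) (y | y) h <;>
      first | exact h.elim | simpa using IsLink.left_mem h

/-- The disjoint union of `q` copies of the complete graph on two vertices: the `i`-th copy has
the vertices `(i, false)`, `(i, true)` and the single edge `i`. -/
def copiesK2 (q : ℕ) : Graph (Fin q × Bool) (Fin q) where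
  vertexSet := Set.univ
  edgeSet := Set.univ
  IsLink i x y := x.1 = i ∧ y.1 = i ∧ x.2 ≠ y.2
  isLink_symm _ _ := ⟨fun _ _ h ↦ ⟨h.2.1, h.1, h.2.2.symm⟩⟩
  eq_or_eq_of_isLink_of_isLink := by
    rintro e ⟨_, x⟩ ⟨_, y⟩ ⟨_, z⟩ ⟨_, w⟩ ⟨rfl, rfl, h⟩ ⟨rfl, rfl, h'⟩
    revert h h'
    cases x <;> cases y <;> cases z <;> cases w <;> simp
  edge_mem_iff_exists_isLink i := by
    simp only [Set.mem_univ, true_iff]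
    exact ⟨(i, false), (i, true), rfl, rfl, by simp⟩
  left_mem_of_isLink _ _ _ _ := Set.mem_univ _

/-- The data exhibiting `S` as an odd subdivision of `H`. The vertices of `H` are embedded in `S`,
and the edge `e` of `H`, with ends `x` and `y`, is replaced by the path
`vert e 0, edge e 0, vert e 1, …, edge e (length e - 1), vert e (length e)`
of odd length from the image of `x` to the image of `y`. The paths are internally disjoint, their
internal vertices are new, and together with the images of the vertices of `H` they make up `S`.
Values of `vert e` and `edge e` at larger indices play no role. -/
structure OddSubdivision {α : Type u} {β : Type v} {α' : Type u'} {β' : Type v'}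
    (H : Graph α β) (S : Graph α' β') where
  branch : H.vertexSet ↪ S.vertexSet
  length : H.edgeSet → ℕ
  vert : H.edgeSet → ℕ → S.vertexSet
  edge : H.edgeSet → ℕ → S.edgeSet
  odd_length : ∀ e, Odd (length e)
  ends : ∀ e : H.edgeSet, ∃ x y : H.vertexSet,
    H.IsLink e x y ∧ vert e 0 = branch x ∧ vert e (length e) = branch y
  isLink : ∀ (e : H.edgeSet), ∀ i < length e, S.IsLink (edge e i) (vert e i) (vert e (i + 1))
  internal_ne_branch : ∀ e i, 0 < i → i < length e → ∀ x, vert e i ≠ branch x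
  internal_injective : ∀ e i f j, 0 < i → i < length e → 0 < j → j < length f →
    vert e i = vert f j → e = f ∧ i = j
  edge_injective : ∀ e i f j, i < length e → j < length f →
    edge e i = edge f j → e = f ∧ i = j
  vert_cover : ∀ z : S.vertexSet,
    (∃ x, branch x = z) ∨ ∃ e i, 0 < i ∧ i < length e ∧ vert e i = z
  edge_cover : ∀ g : S.edgeSet, ∃ e i, i < length e ∧ edge e i = g

/-- `S` is an odd subdivision of `H`. -/
def IsOddSubdivision {α : Type u} {β : Type v} {α' : Type u'} {β' : Type v'}
    (H : Graph α β) (S : Graph α' β') : Prop :=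
  Nonempty (OddSubdivision H S)

/-- `G` is isomorphic to the disjoint union of an odd subdivision of `H` and some number
(possibly zero) of copies of `K₂`. -/
def IsOddSubdivisionWithCopiesK2 {α : Type u} {β : Type v} {α' : Type u'} {β' : Type v'}
    (H : Graph α β) (G : Graph α' β') : Prop :=
  ∃ (γ : Type u') (δ : Type v') (S : Graph γ δ) (q : ℕ),
    IsOddSubdivision H S ∧ Nonempty (Isomorphism G (disjointUnion S (copiesK2 q)))

end Graph

/-! Deleting an edge keeps exactly the perfect matchings that avoid it. Components `K₂` lie in every
perfect matching, so they can be split off. In the remaining graph every edge `e` meets another edge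
`f`, and matchings containing `e` avoid `f`; hence fewer than `k` matchings contain any given edge,
besides fewer than `k` avoiding it. This property, `IsTight`, is symmetric under exchanging
"contains" and "avoids". An odd subdivision preserves the set of perfect matchings up to bijection
and makes this exchange on every second edge of a path, so tightness is invariant
(`OddSubdivision.isTight_iff`). It remains to show that every tight graph is an odd subdivision of
one of bounded size.

Suppressing a path `u, v, w, z` whose inner vertices have degree two and whose ends differ shrinks a
tight graph. If no such path is left, each vertex has at least three edges, or is adjacent to such a
vertex, or lies on a double edge that forms a component. A nonempty tight graph has at most `2 * k`
perfect matchings, and each of its edges lies in one of them. This bounds the double edges, the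
neighbours of a given set and the edges, so the point is to bound the vertices with at least three
edges. Three edges at such a vertex lie in three perfect matchings, for which the vertex is rainbow,
so it suffices to bound the rainbow vertices of one triple (`ncard_rainbow_le`).

A triple of perfect matchings is a properly 3-edge-coloured cubic multigraph. With at least six
vertices it has a fourth perfect matching (`exists_nonconstant_colourSelection`); after splicing out
non-rainbow vertices, six rainbow vertices yield a matching `N` in the union that differs there from
all three colours. Replacing each colour by `N` in turn gives three triples with fewer perfect
matchings in their unions, and every rainbow vertex stays rainbow in one of them. Induction gives
the bound `5 * 3 ^ p`. -/

/-! ### A fourth perfect matching in a 3-edge-coloured cubic graph. -/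

section ColouredCubic

variable {V : Type*}

/-- The walk from `v` that applies the maps `a` and `b` alternately, starting with `a`. -/
def alternatingWalk (a b : V → V) (v : V) : ℕ → V
  | 0 => v
  | n + 1 => if n % 2 = 0 then a (alternatingWalk a b v n) else b (alternatingWalk a b v n)

/-- Two fixed-point-free involutions of a finite type trace an even cycle through any point. -/
theorem exists_alternating_cycle [Finite V] {a b : V → V} (ha : a.Involutive) (hb : b.Involutive)
    (ha' : ∀ x, a x ≠ x) (hb' : ∀ x, b x ≠ x) (v : V) :
    ∃ (L : ℕ) (f : ℕ → V), 0 < L ∧ L % 2 = 0 ∧ Set.InjOn f (Set.Iio L) ∧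
      (∀ i < L, i % 2 = 0 → a (f i) = f (i + 1)) ∧
      (∀ i, i + 1 < L → i % 2 = 1 → b (f i) = f (i + 1)) ∧ b (f (L - 1)) = f 0 := by
  set f := alternatingWalk a b v with hf
  have fa : ∀ i, i % 2 = 0 → f (i + 1) = a (f i) := fun i hi ↦ by simp [hf, alternatingWalk, hi]
  have fb : ∀ i, i % 2 = 1 → f (i + 1) = b (f i) := fun i hi ↦ by simp [hf, alternatingWalk, hi]
  -- A return after an odd number of steps starts and ends with the same involution, so it can be
  -- shortened at both ends until a fixed point appears.
  have odd_ne : ∀ d i, f i ≠ f (i + (2 * d + 1)) := by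
    intro d
    induction d with
    | zero =>
      intro i h
      rcases Nat.mod_two_eq_zero_or_one i with hi | hi
      · rw [show i + (2 * 0 + 1) = i + 1 by ring, fa i hi] at h
        exact ha' _ h.symm
      · rw [show i + (2 * 0 + 1) = i + 1 by ring, fb i hi] at h
        exact hb' _ h.symm
    | succ d ih =>
      intro i h
      apply ih (i + 1)
      rcases Nat.mod_two_eq_zero_or_one i with hi | hi
      · rw [show i + (2 * (d + 1) + 1) = (i + 1 + (2 * d + 1)) + 1 by ring, fa _ (by omega)] at h
        rw [fa i hi, h, ha]
      · rw [show i + (2 * (d + 1) + 1) = (i + 1 + (2 * d + 1)) + 1 by ring, fb _ (by omega)] at h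
        rw [fb i hi, h, hb]
  have back : ∀ i d, f i = f (i + 2 * d) → f 0 = f (2 * d) := by
    intro i d
    induction i with
    | zero => simp
    | succ i ih =>
      intro h
      apply ih
      rw [show i + 1 + 2 * d = (i + 2 * d) + 1 by ring] at h
      rcases Nat.mod_two_eq_zero_or_one i with hi | hi
      · rw [fa i hi, fa _ (by omega)] at h
        exact ha.injective h
      · rw [fb i hi, fb _ (by omega)] at h
        exact hb.injective h
  have ret : ∀ i j, i < j → f i = f j → ∃ d, 0 < d ∧ j - i = 2 * d ∧ f 0 = f (2 * d) := by
    intro i j hij h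
    rcases Nat.even_or_odd' (j - i) with ⟨d, hd | hd⟩
    · refine ⟨d, by omega, hd, back i d ?_⟩
      rw [h]
      congr 1
      omega
    · exact absurd (h.trans (by congr 1; omega)) (odd_ne d i)
  have hex : ∃ d, 0 < d ∧ f 0 = f (2 * d) := by
    obtain ⟨i, j, hne, h⟩ := Finite.exists_ne_map_eq_of_infinite f
    rcases lt_or_gt_of_ne hne with hlt | hlt
    · obtain ⟨d, hd, -, h⟩ := ret i j hlt h
      exact ⟨d, hd, h⟩
    · obtain ⟨d, hd, -, h⟩ := ret j i hlt h.symm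
      exact ⟨d, hd, h⟩
  classical
  obtain ⟨hd, hfd⟩ := Nat.find_spec hex
  set d := Nat.find hex with hdef
  have no_ret : ∀ i j, i < j → j < 2 * d → f i ≠ f j := by
    intro i j hij hj h
    obtain ⟨d', hd', he, h'⟩ := ret i j hij h
    have := Nat.find_min' hex ⟨hd', h'⟩
    omega
  refine ⟨2 * d, f, by omega, by omega, ?_, fun i _ hi ↦ (fa i hi).symm,
    fun i _ hi ↦ (fb i hi).symm, ?_⟩
  · intro i hi j hj h
    by_contra hne
    rcases lt_or_gt_of_ne hne with hlt | hlt
    · exact no_ret i j hlt hj h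
    · exact no_ret j i hlt hi h.symm
  · rw [← fb _ (by omega), hfd]
    congr 1
    omega

/-- A parity-preserving fixed-point-free involution of `{0, …, L - 1}`, drawn by chords of a
circle, has a chord joining even numbers that crosses a chord joining odd numbers. -/
theorem exists_crossing_chords {L : ℕ} {t : ℕ → ℕ} (hL : 0 < L) (ht : ∀ i < L, t i < L)
    (htt : ∀ i < L, t (t i) = i) (hne : ∀ i < L, t i ≠ i) (hpar : ∀ i < L, t i % 2 = i % 2) :
    ∃ p q r s, p < q ∧ q < r ∧ r < s ∧ s < L ∧ t p = r ∧ t q = s ∧ p % 2 ≠ q % 2 := by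
  -- A shortest chord works: by parity it encloses `x + 1`, and the chord at `x + 1` must leave the
  -- enclosed interval, as it would be shorter otherwise.
  have hex : ∃ d x, x < L ∧ x < t x ∧ t x - x = d := by
    rcases lt_or_gt_of_ne (hne 0 hL) with h | h
    · omega
    · exact ⟨_, 0, hL, h, rfl⟩
  classical
  obtain ⟨x, hx, hxy, hd⟩ := Nat.find_spec hex
  have hp := hpar x hx
  have hy := ht x hx
  have hw : x + 1 < L := by omega
  have hpw := hpar (x + 1) hw
  have hz := ht (x + 1) hw
  have hnw := hne (x + 1) hw
  have hinv := htt (x + 1) hw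
  have hinvx := htt x hx
  rcases lt_trichotomy (t (x + 1)) x with h | h | h
  · exact ⟨t (x + 1), x, x + 1, t x, h, by omega, by omega, hy, hinv, rfl, by omega⟩
  · omega
  rcases lt_trichotomy (t (x + 1)) (t x) with h' | h' | h'
  · have := Nat.find_min' hex ⟨x + 1, hw, by omega, rfl⟩
    omega
  · omega
  · exact ⟨x, x + 1, t x, t (x + 1), by omega, by omega, h', hz, rfl, rfl, by omega⟩

/-- A perfect matching of a properly 3-edge-coloured cubic graph, described by the colour `c x` of
its edge at each vertex `x`; the edge of colour `i` at `x` leads to `σ i x`. -/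
def IsColourSelection (σ : Fin 3 → V → V) (c : V → Fin 3) : Prop :=
  ∀ x, c (σ (c x) x) = c x

/-- Colours 1 and 2 form a Hamiltonian cycle here, with the edges of colour 0 as chords `t`. A
matching is then a labelling of the positions that agrees at the two ends of every edge; `C3`
concerns the edge that closes the cycle. -/
theorem isColourSelection_of_cycle {σ : Fin 3 → V → V} {L : ℕ} {f : ℕ → V} {t : ℕ → ℕ}
    (hL : 0 < L) (hL2 : L % 2 = 0)
    (hinv : ∀ i, (σ i).Involutive)
    (hinj : Set.InjOn f (Set.Iio L)) (hsurj : ∀ x, ∃ i < L, f i = x)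
    (h1 : ∀ i < L, i % 2 = 0 → σ 1 (f i) = f (i + 1))
    (h2 : ∀ i, i + 1 < L → i % 2 = 1 → σ 2 (f i) = f (i + 1)) (h3 : σ 2 (f (L - 1)) = f 0)
    (ht : ∀ i < L, t i < L) (h0 : ∀ i < L, σ 0 (f i) = f (t i)) (C : ℕ → Fin 3)
    (C0 : ∀ i < L, C i = 0 → C (t i) = 0)
    (C1 : ∀ i, i + 1 < L → i % 2 = 0 → (C i = 1 ↔ C (i + 1) = 1))
    (C2 : ∀ i, i + 1 < L → i % 2 = 1 → (C i = 2 ↔ C (i + 1) = 2))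
    (C3 : C (L - 1) = 2 ↔ C 0 = 2) :
    ∃ c : V → Fin 3, IsColourSelection σ c ∧ ∀ i < L, c (f i) = C i := by
  choose g hg hfg using hsurj
  have hgf : ∀ i < L, g (f i) = i := fun i hi ↦ hinj (hg _) hi (hfg _)
  refine ⟨fun x ↦ C (g x), fun x ↦ ?_, fun i hi ↦ by simp only [hgf i hi]⟩
  obtain ⟨i, hi, rfl⟩ : ∃ i < L, f i = x := ⟨g x, hg x, hfg x⟩
  simp only [hgf i hi]
  have hcases : C i = 0 ∨ C i = 1 ∨ C i = 2 := by generalize C i = z; fin_cases z <;> simp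
  rcases hcases with h | h | h
  · rw [h, h0 i hi, hgf _ (ht i hi), C0 i hi h]
  · rw [h]
    rcases Nat.mod_two_eq_zero_or_one i with hp | hp
    · rw [h1 i hi hp, hgf _ (by omega), ← C1 i (by omega) hp, h]
    · obtain ⟨j, rfl⟩ : ∃ j, i = j + 1 := ⟨i - 1, by omega⟩
      rw [← h1 j (by omega) (by omega), hinv, hgf _ (by omega), C1 j hi (by omega), h]
  · rw [h]
    rcases Nat.mod_two_eq_zero_or_one i with hp | hp
    · rcases Nat.eq_zero_or_pos i with rfl | hpos
      · rw [← h3, hinv, hgf _ (by omega), C3, h]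
      · obtain ⟨j, rfl⟩ : ∃ j, i = j + 1 := ⟨i - 1, by omega⟩
        rw [← h2 j (by omega) (by omega), hinv, hgf _ (by omega), C2 j hi (by omega), h]
    · by_cases hl : i + 1 < L
      · rw [h2 i hl hp, hgf _ hl, ← C2 i hl hp, h]
      · obtain rfl : i = L - 1 := by omega
        rw [h3, hgf _ hL, ← C3, h]

/-- A properly 3-edge-coloured cubic graph with at least six vertices has a perfect matching that
is not a colour class. -/
theorem exists_nonconstant_colourSelection [Fintype V] {σ : Fin 3 → V → V}
    (hinv : ∀ i, (σ i).Involutive) (hne : ∀ i x, σ i x ≠ x) (hcard : 6 ≤ Fintype.card V) :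
    ∃ c, IsColourSelection σ c ∧ ∃ x y, c x ≠ c y := by
  classical
  have : Nonempty V := Fintype.card_pos_iff.1 (by omega)
  obtain ⟨v⟩ := this
  obtain ⟨L, f, hL, hL2, hinj, h1, h2, h3⟩ :=
    exists_alternating_cycle (hinv 1) (hinv 2) (hne 1) (hne 2) v
  by_cases hsurj : ∀ x, ∃ i < L, f i = x
  swap
  · push Not at hsurj
    obtain ⟨y, hy⟩ := hsurj
    have closed : ∀ x, (∃ i < L, f i = x) → (∃ i < L, f i = σ 1 x) ∧ ∃ i < L, f i = σ 2 x := by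
      rintro _ ⟨i, hi, rfl⟩
      rcases Nat.mod_two_eq_zero_or_one i with hp | hp
      · refine ⟨⟨i + 1, by omega, (h1 i hi hp).symm⟩, ?_⟩
        rcases Nat.eq_zero_or_pos i with rfl | hpos
        · exact ⟨L - 1, by omega, by rw [← h3, hinv]⟩
        · obtain ⟨j, rfl⟩ : ∃ j, i = j + 1 := ⟨i - 1, by omega⟩
          exact ⟨j, by omega, by rw [← h2 j (by omega) (by omega), hinv]⟩
      · obtain ⟨j, rfl⟩ : ∃ j, i = j + 1 := ⟨i - 1, by omega⟩
        refine ⟨⟨j, by omega, by rw [← h1 j (by omega) (by omega), hinv]⟩, ?_⟩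
        by_cases hl : j + 1 + 1 < L
        · exact ⟨j + 1 + 1, hl, (h2 _ hl hp).symm⟩
        · exact ⟨0, hL, by rw [← h3]; congr 2; omega⟩
    -- The cycle is not Hamiltonian: take colour 1 on it and colour 2 elsewhere.
    refine ⟨fun x ↦ if ∃ i < L, f i = x then 1 else 2, fun x ↦ ?_, f 0, y, ?_⟩
    · by_cases hx : ∃ i < L, f i = x
      · simp only [if_pos hx, if_pos (closed x hx).1]
      · have : ¬ ∃ i < L, f i = σ 2 x := fun h ↦ hx (by simpa [hinv 2 x] using (closed _ h).2)
        simp only [if_neg hx, if_neg this]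
    · simp only [if_pos (show ∃ i < L, f i = f 0 from ⟨0, hL, rfl⟩),
        if_neg (show ¬ ∃ i < L, f i = y by push Not; exact hy)]
      decide
  have hcardL : Fintype.card V ≤ L := by
    have hsub : (Finset.univ : Finset V) ⊆ (Finset.range L).image f := fun x _ ↦ by
      obtain ⟨i, hi, rfl⟩ := hsurj x
      exact Finset.mem_image_of_mem _ (Finset.mem_range.2 hi)
    calc Fintype.card V ≤ ((Finset.range L).image f).card := Finset.card_le_card hsub
      _ ≤ L := Finset.card_image_le.trans (by simp)
  have hchord : ∀ i, ∃ j, i < L → j < L ∧ f j = σ 0 (f i) := fun i ↦ by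
    obtain ⟨j, hj, h⟩ := hsurj (σ 0 (f i))
    exact ⟨j, fun _ ↦ ⟨hj, h⟩⟩
  choose t ht' using hchord
  have ht : ∀ i < L, t i < L := fun i hi ↦ (ht' i hi).1
  have h0 : ∀ i < L, σ 0 (f i) = f (t i) := fun i hi ↦ (ht' i hi).2.symm
  have htt : ∀ i < L, t (t i) = i := fun i hi ↦ hinj (ht _ (ht i hi)) hi (by
    rw [← h0 _ (ht i hi), ← h0 i hi, hinv])
  have htne : ∀ i < L, t i ≠ i := fun i hi h ↦ hne 0 (f i) (by rw [h0 i hi, h])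
  have key := isColourSelection_of_cycle hL hL2 hinv hinj hsurj h1 h2 h3 ht h0
  by_cases hpar : ∀ i < L, t i % 2 = i % 2
  · obtain ⟨p, q, r, s, hpq, hqr, hrs, hs, rfl, rfl, hpar'⟩ :=
      exists_crossing_chords hL ht htt htne hpar
    have htp := htt p (by omega)
    have htq := htt q (by omega)
    have hpp := hpar p (by omega)
    have hqq := hpar q (by omega)
    set r := t p with hr
    set s := t q with hs'
    -- Both crossing chords are used. Since `p ≡ r` and `q ≡ s` have opposite parities, the four
    -- remaining arcs have even order and are matched along the cycle; the parity of the first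
    -- vertex of an arc decides between colours 1 and 2.
    obtain ⟨c, hc, hcC⟩ := key (fun i ↦ if i = p ∨ i = q ∨ i = r ∨ i = s then 0 else
      if ((p < i ∧ i < q) ∨ (r < i ∧ i < s)) ↔ p % 2 = 0 then 2 else 1)
      (by
        intro i hi h
        have : i = p ∨ i = q ∨ i = r ∨ i = s := by
          by_contra hn
          simp only [if_neg hn] at h
          split_ifs at h <;> exact absurd h (by decide)
        have : t i = p ∨ t i = q ∨ t i = r ∨ t i = s := by
          rcases this with rfl | rfl | rfl | rfl <;> simp [htp, htq, ← hr, ← hs']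
        simp only [if_pos this])
      (by
        intro i hi h
        split_ifs <;> first
          | exact iff_of_true rfl rfl
          | exact iff_of_false (by decide) (by decide)
          | (exfalso; omega))
      (by
        intro i hi h
        split_ifs <;> first
          | exact iff_of_true rfl rfl
          | exact iff_of_false (by decide) (by decide)
          | (exfalso; omega))
      (by
        split_ifs <;> first
          | exact iff_of_true rfl rfl
          | exact iff_of_false (by decide) (by decide)
          | (exfalso; omega))
    -- Six vertices are needed here: in `K₄` the two crossing chords form the whole colour class 0.
    obtain ⟨j, hj, hjn⟩ : ∃ j < L, ¬ (j = p ∨ j = q ∨ j = r ∨ j = s) := by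
      by_contra! h
      have hsub : Finset.range L ⊆ {p, q, r, s} := fun j hj ↦ by
        simpa using h j (Finset.mem_range.1 hj)
      have := (Finset.card_le_card hsub).trans Finset.card_le_four
      rw [Finset.card_range] at this
      omega
    refine ⟨c, hc, f p, f j, ?_⟩
    rw [hcC p (by omega), hcC j hj, if_pos (Or.inl rfl), if_neg hjn]
    split_ifs <;> decide
  · push Not at hpar
    obtain ⟨x, y, hxy, hy, htx, hty, hpxy⟩ :
        ∃ x y, x < y ∧ y < L ∧ t x = y ∧ t y = x ∧ x % 2 ≠ y % 2 := by
      obtain ⟨i, hi, hip⟩ := hpar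
      rcases lt_or_gt_of_ne (htne i hi) with h | h
      · exact ⟨t i, i, h, hi, htt i hi, rfl, hip⟩
      · exact ⟨i, t i, h, ht i hi, rfl, htt i hi, hip.symm⟩
    -- A single chord between positions of opposite parity leaves two arcs of even order.
    obtain ⟨c, hc, hcC⟩ := key (fun i ↦ if i = x ∨ i = y then 0 else
      if (x < i ∧ i < y) ↔ x % 2 = 0 then 2 else 1)
      (by
        intro i hi h
        have : i = x ∨ i = y := by
          by_contra hn
          simp only [if_neg hn] at h
          split_ifs at h <;> exact absurd h (by decide)
        have : t i = x ∨ t i = y := by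
          rcases this with rfl | rfl
          · exact Or.inr htx
          · exact Or.inl hty
        simp only [if_pos this])
      (by
        intro i hi h
        split_ifs <;> first
          | exact iff_of_true rfl rfl
          | exact iff_of_false (by decide) (by decide)
          | (exfalso; omega))
      (by
        intro i hi h
        split_ifs <;> first
          | exact iff_of_true rfl rfl
          | exact iff_of_false (by decide) (by decide)
          | (exfalso; omega))
      (by
        split_ifs <;> first
          | exact iff_of_true rfl rfl
          | exact iff_of_false (by decide) (by decide)
          | (exfalso; omega))
    obtain ⟨j, hj, hjn⟩ : ∃ j < L, ¬ (j = x ∨ j = y) := by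
      by_contra! h
      have hsub : Finset.range L ⊆ {x, y} := fun j hj ↦ by
        simpa using h j (Finset.mem_range.1 hj)
      have := (Finset.card_le_card hsub).trans Finset.card_le_two
      rw [Finset.card_range] at this
      omega
    refine ⟨c, hc, f x, f j, ?_⟩
    rw [hcC x (by omega), hcC j hj, if_pos (Or.inl rfl), if_neg hjn]
    split_ifs <;> decide

end ColouredCubic

/-! ### Splicing out multiple edges. -/

section ColouredCubic

/-- The colour involutions that remain after the matched pair `v`, `w` is spliced out. -/
def spliceOut {V : Type*} [DecidableEq V] (σ : Fin 3 → V → V) (v w : V) (l : Fin 3) (x : V) : V :=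
  if σ l x = v then σ l w else if σ l x = w then σ l v else σ l x

/-- Suppose that every vertex outside `R` is joined by a multiple edge to another vertex outside
`R`. If `R` has at least six vertices, then some perfect matching uses two colours on `R`. -/
theorem exists_colourSelection_nonconstant_on (n : ℕ) : ∀ {V : Type*} [Fintype V]
    {σ : Fin 3 → V → V} {R : Set V}, Fintype.card V = n →
    (∀ i, (σ i).Involutive) → (∀ i x, σ i x ≠ x) →
    (∀ x ∉ R, ∃ i j, i ≠ j ∧ σ i x = σ j x ∧ σ i x ∉ R) → 6 ≤ R.ncard →
    ∃ c, IsColourSelection σ c ∧ ∃ x ∈ R, ∃ y ∈ R, c x ≠ c y := by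
  induction n using Nat.strong_induction_on with
  | _ n ih =>
  intro V _ σ R hn hinv hne hR hcard
  classical
  by_cases hall : ∀ x, x ∈ R
  · obtain ⟨c, hc, x, y, hxy⟩ := exists_nonconstant_colourSelection hinv hne
      (hcard.trans (by rw [← Nat.card_eq_fintype_card]; exact Set.ncard_le_card R))
    exact ⟨c, hc, x, hall x, y, hall y, hxy⟩
  push Not at hall
  obtain ⟨v, hv⟩ := hall
  obtain ⟨i, j, hij, hvij, hw⟩ := hR v hv
  obtain ⟨w, hw_def⟩ : ∃ w, w = σ i v := ⟨_, rfl⟩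
  rw [← hw_def] at hw hvij
  have hvw : v ≠ w := fun h ↦ hne i v (hw_def ▸ h.symm)
  have iv : σ i v = w := hw_def.symm
  have jv : σ j v = w := hvij.symm
  have iw : σ i w = v := by rw [← iv, hinv]
  have jw : σ j w = v := by rw [← jv, hinv]
  -- The third colour: only its edges change when `v` and `w` are removed.
  obtain ⟨k, hk⟩ : ∃ k, ∀ l, l ≠ i → l ≠ j → l = k :=
    (by decide : ∀ i j : Fin 3, i ≠ j → ∃ k, ∀ l, l ≠ i → l ≠ j → l = k) i j hij
  have inj : ∀ l {x y}, σ l x = σ l y → x = y := fun l _ _ h ↦ (hinv l).injective h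
  let V' := {x : V // x ≠ v ∧ x ≠ w}
  have hmem : ∀ l (x : V'), spliceOut σ v w l x ≠ v ∧ spliceOut σ v w l x ≠ w := by
    rintro l ⟨x, hxv, hxw⟩
    have h1 := hinv l x
    have h2 := hne l v
    have h3 := hne l w
    have h4 := @inj l x v
    have h5 := @inj l x w
    simp only [spliceOut]
    grind
  let σ' : Fin 3 → V' → V' := fun l x ↦ ⟨spliceOut σ v w l x, hmem l x⟩
  have hinv' : ∀ l, (σ' l).Involutive := by
    rintro l ⟨x, hxv, hxw⟩
    apply Subtype.ext
    have h1 := hinv l x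
    have h2 := hinv l v
    have h3 := hinv l w
    simp only [σ', spliceOut]
    grind
  have hne' : ∀ l x, σ' l x ≠ x := by
    rintro l ⟨x, hxv, hxw⟩ h
    have h := congrArg Subtype.val h
    have h0 := hinv l x
    have h1 := hne l x
    have h2 := hinv l v
    have h3 := hinv l w
    simp only [σ', spliceOut] at h
    grind
  have hR' : ∀ x ∉ (Subtype.val ⁻¹' R : Set V'), ∃ i j, i ≠ j ∧ σ' i x = σ' j x ∧
      σ' i x ∉ (Subtype.val ⁻¹' R : Set V') := by
    rintro ⟨x, hxv, hxw⟩ hx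
    obtain ⟨a, b, hab, habx, hax⟩ := hR x hx
    have h1 := hinv a x
    have h2 := hinv b x
    have h3 := hk a
    have h4 := hk b
    -- One of `a`, `b` is `i` or `j`, so a double edge from `x` to `v` or `w` would have to be that
    -- between `v` and `w`. Other double edges thus survive.
    have hyv : σ a x ≠ v := by grind
    have hyw : σ a x ≠ w := by grind
    refine ⟨a, b, hab, Subtype.ext ?_, ?_⟩
    · simp only [σ', spliceOut]
      grind
    · simp only [σ', spliceOut, Set.mem_preimage]
      grind
  have hcard' : Fintype.card V' < n := by
    rw [← hn]
    exact Fintype.card_subtype_lt (x := v) (by simp)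
  have hRcard : (Subtype.val ⁻¹' R : Set V').ncard = R.ncard := by
    rw [Set.ncard_preimage_of_injective_subset_range Subtype.val_injective]
    intro x hx
    exact ⟨⟨x, by rintro rfl; exact hv hx, by rintro rfl; exact hw hx⟩, rfl⟩
  obtain ⟨c', hc', x, hx, y, hy, hxy⟩ :=
    ih _ hcard' rfl hinv' hne' hR' (hRcard ▸ hcard)
  -- If the new edge of colour `k` is selected, both old edges replacing it are taken; otherwise `v`
  -- and `w` are matched to each other by colour `i`.
  let d : Fin 3 := if h : ∃ h : σ k v ≠ v ∧ σ k v ≠ w, c' ⟨σ k v, h⟩ = k then k else i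
  have hd : d = k ∨ d = i := by simp only [d]; split_ifs <;> simp
  let c : V → Fin 3 := fun x ↦ if h : x ≠ v ∧ x ≠ w then c' ⟨x, h⟩ else d
  have cv : c v = d := by simp [c]
  have cw : c w = d := by simp [c]
  have cx : ∀ x (h : x ≠ v ∧ x ≠ w), c x = c' ⟨x, h⟩ := fun x h ↦ by simp only [c, dif_pos h]
  have hdk : d = k → (∃ h : σ k v ≠ v ∧ σ k v ≠ w, c' ⟨σ k v, h⟩ = k) ∨ k = i := by
    intro h
    by_contra! hcon
    simp only [d] at h
    rw [dif_neg (by push Not; exact hcon.1)] at h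
    exact hcon.2 h.symm
  have hkd : (∃ h : σ k v ≠ v ∧ σ k v ≠ w, c' ⟨σ k v, h⟩ = k) → d = k := by
    intro h
    simp only [d, dif_pos h]
  refine ⟨c, fun z ↦ ?_, x, hx, y, hy, by rwa [cx x x.2, cx y y.2]⟩
  by_cases hz : z ≠ v ∧ z ≠ w
  · rw [cx z hz]
    have hsel := hc' ⟨z, hz⟩
    have hsel' : σ' (c' ⟨z, hz⟩) ⟨z, hz⟩ = ⟨spliceOut σ v w (c' ⟨z, hz⟩) z, hmem _ ⟨z, hz⟩⟩ := rfl
    set l := c' ⟨z, hz⟩ with hl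
    have hzz := hinv l z
    by_cases hyv : σ l z = v
    · rw [hyv, cv]
      have hlk : l = k := hk l (by rintro h; rw [h] at hyv hzz; grind) (by
        rintro h; rw [h] at hyv hzz; grind)
      rw [hlk]
      rw [hyv, hlk] at hzz
      exact hkd ⟨by rw [hzz]; exact hz, by simp only [hzz]; exact hlk⟩
    by_cases hyw : σ l z = w
    · rw [hyw, cw]
      have hlk : l = k := hk l (by rintro h; rw [h] at hyw hzz; grind) (by
        rintro h; rw [h] at hyw hzz; grind)
      have hs : spliceOut σ v w l z = σ k v := by
        rw [spliceOut, if_neg hyv, if_pos hyw, hlk]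
      rw [hlk]
      refine hkd ⟨hs ▸ hmem l ⟨z, hz⟩, ?_⟩
      rw [hsel'] at hsel
      exact (congrArg c' (Subtype.ext hs.symm)).trans (hsel.trans hlk)
    · have hs : spliceOut σ v w l z = σ l z := by
        simp only [spliceOut, if_neg hyv, if_neg hyw]
      rw [cx _ (hs ▸ hmem l ⟨z, hz⟩)]
      rw [hsel'] at hsel
      exact (congrArg c' (Subtype.ext hs.symm)).trans hsel
  · have hcz : c z = d := by simp only [c, dif_neg hz]
    rw [hcz]
    by_cases hdi : d = i
    · rw [hdi]
      have : z = v ∨ z = w := by tauto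
      rcases this with rfl | rfl
      · rw [iv, cw, hdi]
      · rw [iw, cv, hdi]
    · have hdk' : d = k := hd.resolve_right hdi
      obtain ⟨h, hu⟩ := (hdk hdk').resolve_right (fun h ↦ hdi (hdk'.trans h))
      rw [hdk']
      have : z = v ∨ z = w := by tauto
      rcases this with rfl | rfl
      · rw [cx _ h, hu]
      · have hs : spliceOut σ v z k (σ k v) = σ k z := by
          simp only [spliceOut, hinv k v, if_true]
        have hsel := hc' ⟨σ k v, h⟩
        rw [hu] at hsel
        rw [cx _ (hs ▸ hmem k ⟨σ k v, h⟩)]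
        exact (congrArg c' (Subtype.ext hs.symm)).trans hsel

end ColouredCubic

/-! ### Rainbow vertices of three perfect matchings. -/

namespace Graph

section Rainbow

variable {α β : Type*} {G : Graph α β}

theorem IsPerfectMatching.exists_inc {M : Set β} (hM : G.IsPerfectMatching M) {x : α}
    (hx : x ∈ G.vertexSet) : ∃ e ∈ M, G.Inc e x :=
  let ⟨e, he, _⟩ := hM.2 x hx
  ⟨e, he⟩

theorem IsPerfectMatching.eq_of_inc {M : Set β} (hM : G.IsPerfectMatching M) {e f : β} {x : α}
    (he : e ∈ M) (hf : f ∈ M) (hex : G.Inc e x) (hfx : G.Inc f x) : e = f :=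
  (hM.2 x hex.vertex_mem).unique ⟨he, hex⟩ ⟨hf, hfx⟩

/-- The vertices whose edges in the three sets `M i` are distinct. -/
def rainbow (G : Graph α β) (M : Fin 3 → Set β) : Set α :=
  {x ∈ G.vertexSet | ∀ e, G.Inc e x → ∀ i j, e ∈ M i → e ∈ M j → i = j}

/-- If three perfect matchings have at least six rainbow vertices, then their union contains a
perfect matching that agrees with none of them on the rainbow vertices. -/
theorem exists_isPerfectMatching_of_rainbow [G.Loopless] (hV : G.vertexSet.Finite)
    {M : Fin 3 → Set β} (hM : ∀ i, G.IsPerfectMatching (M i)) (hR : 6 ≤ (G.rainbow M).ncard) :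
    ∃ N, G.IsPerfectMatching N ∧ N ⊆ ⋃ i, M i ∧
      ∀ i, ∃ x ∈ G.rainbow M, ∃ e ∈ M i, G.Inc e x ∧ e ∉ N := by
  classical
  have hex : ∀ i (x : G.vertexSet), ∃ (e : β) (y : G.vertexSet), e ∈ M i ∧ G.IsLink e x y := by
    intro i x
    obtain ⟨e, he, y, hy⟩ := (hM i).exists_inc x.2
    exact ⟨e, ⟨y, hy.right_mem⟩, he, hy⟩
  choose m σ hm hσ using hex
  have huniq : ∀ i (x : G.vertexSet) e, e ∈ M i → G.Inc e x → e = m i x := fun i x e he hx ↦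
    (hM i).eq_of_inc he (hm i x) hx (hσ i x).inc_left
  have hmσ : ∀ i x, m i (σ i x) = m i x := fun i x ↦
    (huniq i _ _ (hm i x) (hσ i x).inc_right).symm
  have hinv : ∀ i, (σ i).Involutive := by
    intro i x
    have h := hσ i (σ i x)
    rw [hmσ] at h
    exact Subtype.ext (h.right_unique (hσ i x).symm)
  have hne : ∀ i x, σ i x ≠ x := fun i x h ↦ (hσ i x).ne (congrArg Subtype.val h).symm
  have := hV.fintype
  let R : Set G.vertexSet := Subtype.val ⁻¹' G.rainbow M
  have hRcard : R.ncard = (G.rainbow M).ncard :=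
    Set.ncard_preimage_of_injective_subset_range Subtype.val_injective
      fun x hx ↦ ⟨⟨x, hx.1⟩, rfl⟩
  have hnotR : ∀ x : G.vertexSet, x ∉ R ↔ ∃ i j, i ≠ j ∧ m i x = m j x := by
    intro x
    constructor
    · intro hx
      simp only [R, Set.mem_preimage, rainbow, Set.mem_ofPred_eq, not_and, not_forall] at hx
      obtain ⟨e, he, i, j, hi, hj, hij⟩ := hx x.2
      exact ⟨i, j, hij, by rw [← huniq i x e hi he, ← huniq j x e hj he]⟩
    · rintro ⟨i, j, hij, h⟩ hx
      exact hij (hx.2 (m i x) (hσ i x).inc_left i j (hm i x) (h ▸ hm j x))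
  have hRσ : ∀ x ∉ R, ∃ i j, i ≠ j ∧ σ i x = σ j x ∧ σ i x ∉ R := by
    intro x hx
    obtain ⟨i, j, hij, h⟩ := (hnotR x).1 hx
    have hs : σ i x = σ j x := Subtype.ext ((hσ i x).right_unique (h ▸ hσ j x))
    refine ⟨i, j, hij, hs, (hnotR _).2 ⟨i, j, hij, ?_⟩⟩
    rw [hmσ, h, hs, hmσ]
  obtain ⟨c, hc, x, hx, y, hy, hxy⟩ :=
    exists_colourSelection_nonconstant_on _ rfl hinv hne hRσ (hRcard ▸ hR)
  -- An edge picked at one end is also picked at the other, as `c` has the same value there.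
  have hN : ∀ (z : G.vertexSet) e, e ∈ Set.range (fun z ↦ m (c z) z) → G.Inc e z →
      e = m (c z) z := by
    rintro z _ ⟨w, rfl⟩ hz
    rcases hz.eq_or_eq_of_isLink (hσ (c w) w) with h | h
    · rw [Subtype.ext h]
    · have hzw : z = σ (c w) w := Subtype.ext h
      have hcw : c (σ (c w) w) = c w := hc w
      rw [hzw]
      simp only [hcw, hmσ]
  have hnot : ∀ i (z : G.vertexSet), z ∈ R → c z ≠ i → ∃ x ∈ G.rainbow M, ∃ e ∈ M i,
      G.Inc e x ∧ e ∉ Set.range (fun z ↦ m (c z) z) := by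
    refine fun i z hz hne ↦ ⟨z, hz, m i z, hm i z, (hσ i z).inc_left, fun hmem ↦ ?_⟩
    have := hN z _ hmem (hσ i z).inc_left
    exact (hnotR z).2 ⟨_, _, hne.symm, this⟩ hz
  refine ⟨Set.range (fun z ↦ m (c z) z), ⟨?_, fun z hz ↦ ?_⟩, ?_, fun i ↦ ?_⟩
  · rintro _ ⟨z, rfl⟩
    exact (hσ _ z).edge_mem
  · exact ⟨m (c ⟨z, hz⟩) ⟨z, hz⟩, ⟨⟨_, rfl⟩, (hσ _ ⟨z, hz⟩).inc_left⟩,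
      fun e he ↦ hN ⟨z, hz⟩ e he.1 he.2⟩
  · rintro _ ⟨z, rfl⟩
    exact Set.mem_iUnion.2 ⟨c z, hm _ z⟩
  · by_cases hxi : c x = i
    · exact hnot i y hy fun h ↦ hxy (hxi.trans h.symm)
    · exact hnot i x hx hxi

theorem finite_perfectMatchings (hE : G.edgeSet.Finite) : G.perfectMatchings.Finite :=
  hE.finite_subsets.subset fun _ hM ↦ hM.1

/-- Three perfect matchings whose union contains few perfect matchings have few rainbow
vertices. -/
theorem ncard_rainbow_le [G.Loopless] (hV : G.vertexSet.Finite) (hE : G.edgeSet.Finite) (p : ℕ) :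
    ∀ {M : Fin 3 → Set β}, (∀ i, G.IsPerfectMatching (M i)) →
      {N ∈ G.perfectMatchings | N ⊆ ⋃ i, M i}.ncard ≤ p → (G.rainbow M).ncard ≤ 5 * 3 ^ p := by
  have hfin : ∀ M : Fin 3 → Set β, {N ∈ G.perfectMatchings | N ⊆ ⋃ i, M i}.Finite :=
    fun M ↦ (finite_perfectMatchings hE).subset (Set.sep_subset _ _)
  have hRfin : ∀ M : Fin 3 → Set β, (G.rainbow M).Finite := fun M ↦ hV.subset (Set.sep_subset _ _)
  induction p with
  | zero =>
    intro M hM hp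
    have h := (Set.ncard_eq_zero (hfin M)).1 (Nat.le_zero.1 hp)
    have : M 0 ∈ {N ∈ G.perfectMatchings | N ⊆ ⋃ i, M i} := ⟨hM 0, Set.subset_iUnion M 0⟩
    rw [h] at this
    exact this.elim
  | succ p ih =>
    intro M hM hp
    by_contra hcon
    have h6 : 6 ≤ (G.rainbow M).ncard := by
      have : 1 ≤ 3 ^ (p + 1) := Nat.one_le_pow _ _ (by norm_num)
      omega
    obtain ⟨N, hN, hNM, hNi⟩ := exists_isPerfectMatching_of_rainbow hV hM h6
    let M' : Fin 3 → Fin 3 → Set β := fun i ↦ Function.update M i N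
    have hM' : ∀ i j, G.IsPerfectMatching (M' i j) := by
      intro i j
      by_cases h : j = i
      · subst h
        simpa [M'] using hN
      · simpa [M', Function.update_of_ne h] using hM j
    have hsub : ∀ i, ⋃ j, M' i j ⊆ ⋃ j, M j := by
      intro i
      refine Set.iUnion_subset fun j ↦ ?_
      by_cases h : j = i
      · subst h
        simpa [M'] using hNM
      · simpa [M', Function.update_of_ne h] using Set.subset_iUnion M j
    -- `M i` itself is lost: at some rainbow vertex its edge belongs to neither `N` nor another `M
    -- j`.
    have hlt : ∀ i, {N ∈ G.perfectMatchings | N ⊆ ⋃ j, M' i j}.ncard ≤ p := by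
      intro i
      have : {N ∈ G.perfectMatchings | N ⊆ ⋃ j, M' i j}.ncard <
          {N ∈ G.perfectMatchings | N ⊆ ⋃ j, M j}.ncard := by
        refine Set.ncard_lt_ncard ⟨fun K hK ↦ ⟨hK.1, hK.2.trans (hsub i)⟩, fun hle ↦ ?_⟩ (hfin M)
        obtain ⟨x, hx, e, he, hex, heN⟩ := hNi i
        have hmem := (hle ⟨hM i, Set.subset_iUnion M i⟩).2 he
        obtain ⟨j, hj⟩ := Set.mem_iUnion.1 hmem
        by_cases h : j = i
        · subst h
          exact heN (by simpa [M'] using hj)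
        · exact h (hx.2 e hex j i (by simpa [M', Function.update_of_ne h] using hj) he)
      omega
    -- If `N` uses the edge of `M i` at `x`, then replacing `M i` by `N` changes nothing at `x`.
    have hcover : G.rainbow M ⊆ G.rainbow (M' 0) ∪ G.rainbow (M' 1) ∪ G.rainbow (M' 2) := by
      intro x hx
      obtain ⟨e, heN, hex⟩ := hN.exists_inc hx.1
      obtain ⟨i, hi⟩ := Set.mem_iUnion.1 (hNM heN)
      have key : x ∈ G.rainbow (M' i) := by
        have hback : ∀ f, G.Inc f x → ∀ a, f ∈ M' i a → f ∈ M a := by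
          intro f hf a ha
          by_cases h : a = i
          · subst h
            have : f = e := hN.eq_of_inc (by simpa [M'] using ha) heN hf hex
            rwa [this]
          · simpa [M', Function.update_of_ne h] using ha
        exact ⟨hx.1, fun f hf a b ha hb ↦ hx.2 f hf a b (hback f hf a ha) (hback f hf b hb)⟩
      fin_cases i
      · exact Or.inl (Or.inl key)
      · exact Or.inl (Or.inr key)
      · exact Or.inr key
    have h1 := Set.ncard_le_ncard hcover (((hRfin _).union (hRfin _)).union (hRfin _))
    have h2 := Set.ncard_union_le (G.rainbow (M' 0) ∪ G.rainbow (M' 1)) (G.rainbow (M' 2))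
    have h3 := Set.ncard_union_le (G.rainbow (M' 0)) (G.rainbow (M' 1))
    have k0 := ih (hM' 0) (hlt 0)
    have k1 := ih (hM' 1) (hlt 1)
    have k2 := ih (hM' 2) (hlt 2)
    rw [pow_succ] at hcon
    omega

end Rainbow

end Graph

/-! ### Perfect matchings of odd subdivisions, and tightness. -/

theorem Set.BijOn.encard_sep_eq {γ δ : Type*} {A : Set γ} {B : Set δ} {φ : γ → δ}
    (h : Set.BijOn φ A B) {p : γ → Prop} {q : δ → Prop} (hpq : ∀ a ∈ A, p a ↔ q (φ a)) :
    {a ∈ A | p a}.encard = {b ∈ B | q b}.encard := by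
  have : {b ∈ B | q b} = φ '' {a ∈ A | p a} := by
    ext b
    constructor
    · rintro ⟨hb, hq⟩
      obtain ⟨a, ha, rfl⟩ := h.surjOn hb
      exact ⟨a, ⟨ha, (hpq a ha).2 hq⟩, rfl⟩
    · rintro ⟨a, ⟨ha, hp⟩, rfl⟩
      exact ⟨h.mapsTo ha, (hpq a ha).1 hp⟩
  rw [this, (h.injOn.mono (Set.sep_subset _ _)).encard_image]

theorem Set.BijOn.encard_eq {γ δ : Type*} {A : Set γ} {B : Set δ} {φ : γ → δ}
    (h : Set.BijOn φ A B) : A.encard = B.encard := by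
  rw [← h.image_eq, h.injOn.encard_image]

namespace Graph

namespace OddSubdivision

variable {α β α' β' : Type*} {H : Graph α β} {S : Graph α' β'} (o : OddSubdivision H S)

theorem length_pos (e : H.edgeSet) : 0 < o.length e := (o.odd_length e).pos

theorem inc_internal (e : H.edgeSet) {i : ℕ} (hi : 0 < i) (hi' : i < o.length e) (g : β') :
    S.Inc g (o.vert e i) ↔ g = o.edge e (i - 1) ∨ g = o.edge e i := by
  constructor
  · intro hg
    obtain ⟨f, j, hj, hfj⟩ := o.edge_cover ⟨g, hg.edge_mem⟩
    have hgf : g = o.edge f j := by rw [hfj]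
    obtain ⟨x, y, -, hx, hy⟩ := o.ends f
    have hl := o.isLink f j hj
    rw [← hgf] at hl
    rcases hg.eq_or_eq_of_isLink hl with h | h
    · have h : o.vert e i = o.vert f j := Subtype.ext h
      rcases Nat.eq_zero_or_pos j with rfl | hj0
      · exact (o.internal_ne_branch e i hi hi' x (h.trans hx)).elim
      · obtain ⟨rfl, rfl⟩ := o.internal_injective e i f j hi hi' hj0 hj h
        exact Or.inr hgf
    · have h : o.vert e i = o.vert f (j + 1) := Subtype.ext h
      rcases Nat.lt_or_ge (j + 1) (o.length f) with hj1 | hj1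
      · obtain ⟨rfl, rfl⟩ := o.internal_injective e i f (j + 1) hi hi' (by omega) hj1 h
        exact Or.inl hgf
      · rw [show j + 1 = o.length f by omega] at h
        exact (o.internal_ne_branch e i hi hi' y (h.trans hy)).elim
  · rintro (rfl | rfl)
    · have := o.isLink e (i - 1) (by omega)
      rw [Nat.sub_add_cancel hi] at this
      exact this.inc_right
    · exact (o.isLink e i hi').inc_left

theorem inc_branch (x : H.vertexSet) (g : β') :
    S.Inc g (o.branch x) ↔ ∃ e, (g = o.edge e 0 ∧ o.vert e 0 = o.branch x) ∨
      (g = o.edge e (o.length e - 1) ∧ o.vert e (o.length e) = o.branch x) := by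
  constructor
  · intro hg
    obtain ⟨f, j, hj, hfj⟩ := o.edge_cover ⟨g, hg.edge_mem⟩
    have hgf : g = o.edge f j := by rw [hfj]
    have hl := o.isLink f j hj
    rw [← hgf] at hl
    refine ⟨f, ?_⟩
    rcases hg.eq_or_eq_of_isLink hl with h | h
    · have h : o.vert f j = o.branch x := Subtype.ext h.symm
      rcases Nat.eq_zero_or_pos j with rfl | hj0
      · exact Or.inl ⟨hgf, h⟩
      · exact (o.internal_ne_branch f j hj0 hj x h).elim
    · have h : o.vert f (j + 1) = o.branch x := Subtype.ext h.symm
      rcases Nat.lt_or_ge (j + 1) (o.length f) with hj1 | hj1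
      · exact (o.internal_ne_branch f (j + 1) (by omega) hj1 x h).elim
      · have hj2 : j + 1 = o.length f := by omega
        exact Or.inr ⟨by rw [hgf, ← hj2, Nat.add_sub_cancel], hj2 ▸ h⟩
  · have hpos := o.length_pos
    rintro ⟨e, ⟨rfl, h⟩ | ⟨rfl, h⟩⟩
    · rw [← h]
      exact (o.isLink e 0 (hpos e)).inc_left
    · have := o.isLink e (o.length e - 1) (by have := hpos e; omega)
      rw [Nat.sub_add_cancel (hpos e), h] at this
      exact this.inc_right

theorem inc_iff (e : H.edgeSet) (x : H.vertexSet) :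
    H.Inc e x ↔ o.vert e 0 = o.branch x ∨ o.vert e (o.length e) = o.branch x := by
  obtain ⟨y, z, hyz, hy, hz⟩ := o.ends e
  rw [hy, hz, o.branch.injective.eq_iff, o.branch.injective.eq_iff]
  constructor
  · intro h
    exact (h.eq_or_eq_of_isLink hyz).imp (fun h ↦ (Subtype.ext h).symm)
      (fun h ↦ (Subtype.ext h).symm)
  · rintro (rfl | rfl)
    · exact hyz.inc_left
    · exact hyz.inc_right

theorem not_both_ends [H.Loopless] (e : H.edgeSet) (x : H.vertexSet)
    (h0 : o.vert e 0 = o.branch x) (h1 : o.vert e (o.length e) = o.branch x) : False := by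
  obtain ⟨y, z, hyz, hy, hz⟩ := o.ends e
  rw [hy, o.branch.injective.eq_iff] at h0
  rw [hz, o.branch.injective.eq_iff] at h1
  exact hyz.ne (congrArg Subtype.val (h0.trans h1.symm))

/-- The edges of `S` that correspond to a set of edges of `H`: on the path that replaces an edge
in the set these are the odd ones, and on the other paths the even ones. -/
def lift (N : Set β) : Set β' :=
  {g | ∃ e i, i < o.length e ∧ g = o.edge e i ∧ (i % 2 = 0 ↔ (e : β) ∈ N)}

theorem edge_mem_lift {N : Set β} (e : H.edgeSet) {i : ℕ} (hi : i < o.length e) :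
    (o.edge e i : β') ∈ o.lift N ↔ (i % 2 = 0 ↔ (e : β) ∈ N) := by
  constructor
  · rintro ⟨f, j, hj, h, hf⟩
    obtain ⟨rfl, rfl⟩ := o.edge_injective e i f j hi hj (Subtype.ext h)
    exact hf
  · exact fun h ↦ ⟨e, i, hi, rfl, h⟩

theorem last_even (e : H.edgeSet) : (o.length e - 1) % 2 = 0 := by
  have := Nat.odd_iff.1 (o.odd_length e)
  omega

/-- Since the length is odd, the first and last edges of a path have even index, so both lie in the
lift exactly when the original edge lies in `N`. -/
theorem isPerfectMatching_lift [H.Loopless] {N : Set β} (hN : H.IsPerfectMatching N) :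
    S.IsPerfectMatching (o.lift N) := by
  have hpos := o.length_pos
  refine ⟨?_, fun z hz ↦ ?_⟩
  · rintro _ ⟨e, i, -, rfl, -⟩
    exact (o.edge e i).2
  rcases o.vert_cover ⟨z, hz⟩ with ⟨x, hx⟩ | ⟨e, i, hi, hi', hei⟩
  · obtain rfl : (o.branch x : α') = z := congrArg Subtype.val hx
    have hmem : ∀ e : H.edgeSet, ∀ i, i < o.length e → i % 2 = 0 →
        ((o.edge e i : β') ∈ o.lift N ↔ (e : β) ∈ N) := by
      intro e i hi hi2
      rw [o.edge_mem_lift e hi]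
      simp [hi2]
    obtain ⟨e, heN, hex⟩ := hN.exists_inc x.2
    lift e to H.edgeSet using hex.edge_mem
    have huniq : ∀ f : H.edgeSet, (f : β) ∈ N → H.Inc f x → f = e := fun f hf hfx ↦
      Subtype.ext (hN.eq_of_inc hf heN hfx hex)
    have hlast : o.length e - 1 < o.length e := Nat.sub_lt (hpos e) one_pos
    rcases (o.inc_iff e x).1 hex with h | h
    · refine ⟨o.edge e 0, ⟨(hmem e 0 (hpos e) rfl).2 heN, (o.inc_branch x _).2 ⟨e, Or.inl ⟨rfl, h⟩⟩⟩,
        ?_⟩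
      rintro g ⟨hg, hgx⟩
      obtain ⟨f, ⟨rfl, hf⟩ | ⟨rfl, hf⟩⟩ := (o.inc_branch x g).1 hgx
      · rw [huniq f ((hmem f 0 (hpos f) rfl).1 hg) ((o.inc_iff f x).2 (Or.inl hf))]
      · obtain rfl := huniq f ((hmem f _ (Nat.sub_lt (hpos f) one_pos) (o.last_even f)).1 hg)
          ((o.inc_iff f x).2 (Or.inr hf))
        exact (o.not_both_ends f x h hf).elim
    · refine ⟨o.edge e (o.length e - 1), ⟨(hmem e _ hlast (o.last_even e)).2 heN,
        (o.inc_branch x _).2 ⟨e, Or.inr ⟨rfl, h⟩⟩⟩, ?_⟩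
      rintro g ⟨hg, hgx⟩
      obtain ⟨f, ⟨rfl, hf⟩ | ⟨rfl, hf⟩⟩ := (o.inc_branch x g).1 hgx
      · obtain rfl := huniq f ((hmem f 0 (hpos f) rfl).1 hg) ((o.inc_iff f x).2 (Or.inl hf))
        exact (o.not_both_ends f x hf h).elim
      · rw [huniq f ((hmem f _ (Nat.sub_lt (hpos f) one_pos) (o.last_even f)).1 hg)
          ((o.inc_iff f x).2 (Or.inr hf))]
  · obtain rfl : (o.vert e i : α') = z := congrArg Subtype.val hei
    have h1 := o.edge_mem_lift (N := N) e hi'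
    have h2 := o.edge_mem_lift (N := N) e (show i - 1 < o.length e by omega)
    have hinc := o.inc_internal e hi hi'
    by_cases hmem : (o.edge e i : β') ∈ o.lift N
    · refine ⟨o.edge e i, ⟨hmem, (hinc _).2 (Or.inr rfl)⟩, ?_⟩
      rintro g ⟨hg, hgi⟩
      rcases (hinc g).1 hgi with rfl | rfl
      · exfalso
        rw [h1] at hmem
        rw [h2] at hg
        by_cases heN : (e : β) ∈ N <;> simp only [heN, iff_true, iff_false] at hmem hg <;> omega
      · rfl
    · refine ⟨o.edge e (i - 1), ⟨?_, (hinc _).2 (Or.inl rfl)⟩, ?_⟩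
      · rw [h2]
        rw [h1] at hmem
        by_cases heN : (e : β) ∈ N <;> simp only [heN, iff_true, iff_false] at hmem ⊢ <;> omega
      · rintro g ⟨hg, hgi⟩
        rcases (hinc g).1 hgi with rfl | rfl
        · rfl
        · exact (hmem hg).elim

/-- Inner vertices of a path have degree two, so membership in `M` alternates along it and is
determined by the first edge. -/
theorem edge_mem_iff_of_isPerfectMatching {M : Set β'} (hM : S.IsPerfectMatching M)
    (e : H.edgeSet) : ∀ i, i < o.length e →
      ((o.edge e i : β') ∈ M ↔ (i % 2 = 0 ↔ (o.edge e 0 : β') ∈ M)) := by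
  intro i
  induction i with
  | zero => simp
  | succ i ih =>
    intro hi
    have hi0 := ih (by omega)
    have hinc := o.inc_internal e (Nat.succ_pos i) hi
    have hstep : (o.edge e (i + 1) : β') ∈ M ↔ (o.edge e i : β') ∉ M := by
      constructor
      · intro h h'
        have := hM.eq_of_inc h h' ((hinc _).2 (Or.inr rfl)) ((hinc _).2 (Or.inl rfl))
        have := (o.edge_injective e (i + 1) e i hi (by omega) (Subtype.ext this)).2
        omega
      · intro h
        obtain ⟨g, hg, hgi⟩ := hM.exists_inc (o.vert e (i + 1)).2
        rcases (hinc g).1 hgi with rfl | rfl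
        · exact (h hg).elim
        · exact hg
    have hpar : (i + 1) % 2 = 0 ↔ ¬ i % 2 = 0 := by omega
    rw [hstep, hi0, hpar]
    tauto

theorem lift_bijOn [H.Loopless] : Set.BijOn o.lift H.perfectMatchings S.perfectMatchings := by
  have hpos := o.length_pos
  refine ⟨fun N hN ↦ o.isPerfectMatching_lift hN, fun N hN N' hN' h ↦ ?_, fun M hM ↦ ?_⟩
  · have key : ∀ e : H.edgeSet, (e : β) ∈ N ↔ (e : β) ∈ N' := by
      intro e
      have h1 := o.edge_mem_lift (N := N) e (hpos e)
      have h2 := o.edge_mem_lift (N := N') e (hpos e)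
      rw [h] at h1
      simpa using h1.symm.trans h2
    ext e
    exact ⟨fun he ↦ (key ⟨e, hN.1 he⟩).1 he, fun he ↦ (key ⟨e, hN'.1 he⟩).2 he⟩
  · have hM : S.IsPerfectMatching M := hM
    have halt := o.edge_mem_iff_of_isPerfectMatching hM
    have hN : ∀ e : H.edgeSet,
        (e : β) ∈ {e | ∃ h : e ∈ H.edgeSet, (o.edge ⟨e, h⟩ 0 : β') ∈ M} ↔
          (o.edge e 0 : β') ∈ M := fun e ↦ ⟨fun ⟨_, h⟩ ↦ h, fun h ↦ ⟨e.2, h⟩⟩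
    have hlast : ∀ e, (o.edge e (o.length e - 1) : β') ∈ M ↔ (o.edge e 0 : β') ∈ M := by
      intro e
      rw [halt e _ (Nat.sub_lt (hpos e) one_pos)]
      simp [o.last_even e]
    refine ⟨{e | ∃ h : e ∈ H.edgeSet, (o.edge ⟨e, h⟩ 0 : β') ∈ M}, ⟨fun e he ↦ he.1, ?_⟩, ?_⟩
    · intro x hx
      lift x to H.vertexSet using hx
      have hend : ∀ e : H.edgeSet, (o.edge e 0 : β') ∈ M → H.Inc e x →
          ∃ i, i < o.length e ∧ (o.edge e i : β') ∈ M ∧ S.Inc (o.edge e i) (o.branch x) := by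
        intro e he hex
        rcases (o.inc_iff e x).1 hex with h | h
        · exact ⟨0, hpos e, he, (o.inc_branch x _).2 ⟨e, Or.inl ⟨rfl, h⟩⟩⟩
        · exact ⟨_, Nat.sub_lt (hpos e) one_pos, (hlast e).2 he,
            (o.inc_branch x _).2 ⟨e, Or.inr ⟨rfl, h⟩⟩⟩
      obtain ⟨e, heM, hex⟩ : ∃ e : H.edgeSet, (o.edge e 0 : β') ∈ M ∧ H.Inc e x := by
        obtain ⟨g, hg, hgx⟩ := hM.exists_inc (o.branch x).2
        obtain ⟨e, ⟨rfl, h⟩ | ⟨rfl, h⟩⟩ := (o.inc_branch x g).1 hgx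
        · exact ⟨e, hg, (o.inc_iff e x).2 (Or.inl h)⟩
        · exact ⟨e, (hlast e).1 hg, (o.inc_iff e x).2 (Or.inr h)⟩
      refine ⟨e, ⟨(hN e).2 heM, hex⟩, ?_⟩
      rintro f ⟨hf, hfx⟩
      lift f to H.edgeSet using hfx.edge_mem
      obtain ⟨i, hi, hiM, hix⟩ := hend e heM hex
      obtain ⟨j, hj, hjM, hjx⟩ := hend f ((hN f).1 hf) hfx
      rw [(o.edge_injective e i f j hi hj (Subtype.ext (hM.eq_of_inc hiM hjM hix hjx))).1]
    · ext g
      constructor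
      · rintro ⟨e, i, hi, rfl, h⟩
        rw [hN e] at h
        exact (halt e i hi).2 h
      · intro hg
        obtain ⟨e, i, hi, hei⟩ := o.edge_cover ⟨g, hM.1 hg⟩
        obtain rfl : (o.edge e i : β') = g := congrArg Subtype.val hei
        rw [o.edge_mem_lift e hi, hN e]
        exact (halt e i hi).1 hg

end OddSubdivision

/-- `G` has at least `k` perfect matchings, but fewer than `k` of them contain any given edge and
fewer than `k` of them avoid it. -/
structure IsTight {α β : Type*} (k : ℕ) (G : Graph α β) : Prop where
  isMatchable : G.IsMatchable k
  avoid_lt : ∀ e ∈ G.edgeSet, {M ∈ G.perfectMatchings | e ∉ M}.encard < k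
  contain_lt : ∀ e ∈ G.edgeSet, {M ∈ G.perfectMatchings | e ∈ M}.encard < k

/-- Under `lift`, a path edge of even index behaves like the original edge and one of odd index like
its complement. The latter only exchanges the two bounds in `IsTight`. -/
theorem OddSubdivision.isTight_iff {α β α' β' : Type*} {H : Graph α β} {S : Graph α' β'}
    [H.Loopless] (o : OddSubdivision H S) (k : ℕ) : H.IsTight k ↔ S.IsTight k := by
  have hbij := o.lift_bijOn
  have heven : ∀ (e : H.edgeSet) i, i < o.length e → i % 2 = 0 →
      {M ∈ H.perfectMatchings | (e : β) ∈ M}.encard =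
        {M ∈ S.perfectMatchings | (o.edge e i : β') ∈ M}.encard ∧
      {M ∈ H.perfectMatchings | (e : β) ∉ M}.encard =
        {M ∈ S.perfectMatchings | (o.edge e i : β') ∉ M}.encard := by
    intro e i hi hi2
    constructor <;> refine hbij.encard_sep_eq fun N _ ↦ ?_ <;> rw [o.edge_mem_lift e hi] <;>
      simp [hi2]
  have hodd : ∀ (e : H.edgeSet) i, i < o.length e → i % 2 = 1 →
      {M ∈ H.perfectMatchings | (e : β) ∈ M}.encard =
        {M ∈ S.perfectMatchings | (o.edge e i : β') ∉ M}.encard ∧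
      {M ∈ H.perfectMatchings | (e : β) ∉ M}.encard =
        {M ∈ S.perfectMatchings | (o.edge e i : β') ∈ M}.encard := by
    intro e i hi hi2
    constructor <;> refine hbij.encard_sep_eq fun N _ ↦ ?_ <;> rw [o.edge_mem_lift e hi] <;>
      simp [hi2]
  constructor
  · rintro ⟨h1, h2, h3⟩
    have key : ∀ g ∈ S.edgeSet, {M ∈ S.perfectMatchings | g ∉ M}.encard < k ∧
        {M ∈ S.perfectMatchings | g ∈ M}.encard < k := by
      intro g hg
      obtain ⟨e, i, hi, hei⟩ := o.edge_cover ⟨g, hg⟩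
      obtain rfl : (o.edge e i : β') = g := congrArg Subtype.val hei
      rcases Nat.mod_two_eq_zero_or_one i with hp | hp
      · rw [← (heven e i hi hp).1, ← (heven e i hi hp).2]
        exact ⟨h2 e e.2, h3 e e.2⟩
      · rw [← (hodd e i hi hp).1, ← (hodd e i hi hp).2]
        exact ⟨h3 e e.2, h2 e e.2⟩
    exact ⟨by rwa [IsMatchable, ← hbij.encard_eq], fun g hg ↦ (key g hg).1,
      fun g hg ↦ (key g hg).2⟩
  · rintro ⟨h1, h2, h3⟩
    refine ⟨by rwa [IsMatchable, hbij.encard_eq], fun e he ↦ ?_, fun e he ↦ ?_⟩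
    · have := (heven ⟨e, he⟩ 0 (o.length_pos _) rfl).2
      rw [this]
      exact h2 _ (o.edge _ 0).2
    · have := (heven ⟨e, he⟩ 0 (o.length_pos _) rfl).1
      rw [this]
      exact h3 _ (o.edge _ 0).2

end Graph

/-! ### Isomorphisms, edge deletion and components `K₂`. -/

namespace Graph

section

variable {α β α' β' : Type*} {G : Graph α β} {G' : Graph α' β'}

/-- The inverse of an isomorphism. -/
def Isomorphism.symm (φ : Isomorphism G G') : Isomorphism G' G where
  vertexEquiv := φ.vertexEquiv.symm
  edgeEquiv := φ.edgeEquiv.symm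
  isLink_iff e x y := by simp [φ.isLink_iff]

/-- The isomorphism given by maps that are bijective on the vertex and edge sets. -/
noncomputable def Isomorphism.ofBijOn (f : α → α') (g : β → β')
    (hf : Set.BijOn f G.vertexSet G'.vertexSet) (hg : Set.BijOn g G.edgeSet G'.edgeSet)
    (h : ∀ e ∈ G.edgeSet, ∀ x ∈ G.vertexSet, ∀ y ∈ G.vertexSet,
      G.IsLink e x y ↔ G'.IsLink (g e) (f x) (f y)) : Isomorphism G G' where
  vertexEquiv := hf.equiv
  edgeEquiv := hg.equiv
  isLink_iff e x y := h e e.2 x x.2 y y.2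

theorem Isomorphism.inc_iff (φ : Isomorphism G G') (e : G.edgeSet) (x : G.vertexSet) :
    G.Inc e x ↔ G'.Inc (φ.edgeEquiv e) (φ.vertexEquiv x) := by
  constructor
  · rintro ⟨y, hy⟩
    exact ⟨_, (φ.isLink_iff e x ⟨y, hy.right_mem⟩).1 hy⟩
  · rintro ⟨y, hy⟩
    obtain ⟨z, hz⟩ := φ.vertexEquiv.surjective ⟨y, hy.right_mem⟩
    refine ⟨z, (φ.isLink_iff e x z).2 ?_⟩
    rwa [hz]

/-- The image of a set of edges under an isomorphism. -/
def Isomorphism.mapEdges (φ : Isomorphism G G') (M : Set β) : Set β' :=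
  {g | ∃ e : G.edgeSet, (e : β) ∈ M ∧ (φ.edgeEquiv e : β') = g}

theorem Isomorphism.mem_mapEdges (φ : Isomorphism G G') {M : Set β} (e : G.edgeSet) :
    (φ.edgeEquiv e : β') ∈ φ.mapEdges M ↔ (e : β) ∈ M := by
  constructor
  · rintro ⟨f, hf, h⟩
    rwa [← φ.edgeEquiv.injective (Subtype.ext h)]
  · exact fun h ↦ ⟨e, h, rfl⟩

theorem Isomorphism.isPerfectMatching_mapEdges (φ : Isomorphism G G') {M : Set β}
    (hM : G.IsPerfectMatching M) : G'.IsPerfectMatching (φ.mapEdges M) := by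
  refine ⟨?_, fun x hx ↦ ?_⟩
  · rintro _ ⟨e, -, rfl⟩
    exact (φ.edgeEquiv e).2
  obtain ⟨y, hy⟩ := φ.vertexEquiv.surjective ⟨x, hx⟩
  obtain rfl : (φ.vertexEquiv y : α') = x := congrArg Subtype.val hy
  obtain ⟨e, he, hey⟩ := hM.exists_inc y.2
  lift e to G.edgeSet using hey.edge_mem
  refine ⟨φ.edgeEquiv e, ⟨(φ.mem_mapEdges e).2 he, (φ.inc_iff e y).1 hey⟩, ?_⟩
  rintro _ ⟨⟨f, hf, rfl⟩, hfy⟩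
  rw [Subtype.ext (hM.eq_of_inc hf he ((φ.inc_iff f y).2 hfy) hey)]

theorem Isomorphism.bijOn_mapEdges (φ : Isomorphism G G') :
    Set.BijOn φ.mapEdges G.perfectMatchings G'.perfectMatchings := by
  refine ⟨fun M hM ↦ φ.isPerfectMatching_mapEdges hM, fun M hM M' hM' h ↦ ?_, fun M hM ↦
    ⟨φ.symm.mapEdges M, φ.symm.isPerfectMatching_mapEdges hM, ?_⟩⟩
  · have key : ∀ e : G.edgeSet, (e : β) ∈ M ↔ (e : β) ∈ M' := fun e ↦ by
      rw [← φ.mem_mapEdges, h, φ.mem_mapEdges]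
    ext e
    exact ⟨fun he ↦ (key ⟨e, hM.1 he⟩).1 he, fun he ↦ (key ⟨e, hM'.1 he⟩).2 he⟩
  · ext g
    constructor
    · rintro ⟨e, ⟨f, hf, hfe⟩, rfl⟩
      have : φ.edgeEquiv.symm f = e := Subtype.ext hfe
      rwa [← this, Equiv.apply_symm_apply]
    · intro hg
      exact ⟨φ.edgeEquiv.symm ⟨g, hM.1 hg⟩, ⟨⟨g, hM.1 hg⟩, hg, rfl⟩, by simp⟩

end

theorem perfectMatchings_deleteEdges_singleton {α β : Type*} (G : Graph α β) (e : β) :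
    (G.deleteEdges {e}).perfectMatchings = {M ∈ G.perfectMatchings | e ∉ M} := by
  ext M
  constructor
  · rintro ⟨h1, h2⟩
    have he : e ∉ M := fun h ↦ by simpa using h1 h
    refine ⟨⟨fun f hf ↦ (by simpa using h1 hf : f ∈ G.edgeSet ∧ f ≠ e).1, fun x hx ↦ ?_⟩, he⟩
    obtain ⟨f, ⟨hf, hfx⟩, huniq⟩ := h2 x (by simpa using hx)
    refine ⟨f, ⟨hf, (deleteEdges_inc.1 hfx).1⟩, fun g hg ↦ huniq g ⟨hg.1, deleteEdges_inc.2 ⟨hg.2, ?_⟩⟩⟩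
    rintro rfl
    exact he hg.1
  · rintro ⟨hM, he⟩
    have hne : ∀ f ∈ M, f ∉ ({e} : Set β) := by
      rintro f hf rfl
      exact he hf
    refine ⟨fun f hf ↦ by simpa using ⟨hM.1 hf, hne f hf⟩, fun x hx ↦ ?_⟩
    obtain ⟨f, hf, hfx⟩ := hM.exists_inc (by simpa using hx)
    exact ⟨f, ⟨hf, deleteEdges_inc.2 ⟨hfx, hne f hf⟩⟩, fun g hg ↦
      hM.eq_of_inc hg.1 hf (deleteEdges_inc.1 hg.2).1 hfx⟩

theorem isMinimallyMatchable_iff {α β : Type*} {k : ℕ} {G : Graph α β} :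
    G.IsMinimallyMatchable k ↔ G.IsMatchable k ∧
      ∀ e ∈ G.edgeSet, {M ∈ G.perfectMatchings | e ∉ M}.encard < k := by
  simp only [IsMinimallyMatchable, IsMatchable, perfectMatchings_deleteEdges_singleton, not_le]

section CopiesK2

variable {α β : Type*} {S : Graph α β} {q : ℕ}

theorem inc_disjointUnion_inl {e : β ⊕ Fin q} {x : α} :
    (disjointUnion S (copiesK2 q)).Inc e (.inl x) ↔ ∃ f, e = .inl f ∧ S.Inc f x := by
  constructor
  · rcases e with e | e <;> rintro ⟨y | y, h⟩
    · exact ⟨e, rfl, y, h⟩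
    · exact h.elim
    · exact h.elim
    · exact h.elim
  · rintro ⟨f, rfl, y, h⟩
    exact ⟨.inl y, h⟩

theorem inc_disjointUnion_inr {e : β ⊕ Fin q} {x : Fin q × Bool} :
    (disjointUnion S (copiesK2 q)).Inc e (.inr x) ↔ e = .inr x.1 := by
  constructor
  · rcases e with e | e <;> rintro ⟨y | y, h⟩
    · exact h.elim
    · exact h.elim
    · exact h.elim
    · exact congrArg Sum.inr h.1.symm
  · rintro rfl
    exact ⟨.inr (x.1, !x.2), rfl, rfl, by simp⟩

theorem bijOn_perfectMatchings_disjointUnion_copiesK2 (S : Graph α β) (q : ℕ) :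
    Set.BijOn (fun N : Set β ↦ Sum.inl '' N ∪ Set.range (Sum.inr : Fin q → β ⊕ Fin q))
      S.perfectMatchings (disjointUnion S (copiesK2 q)).perfectMatchings := by
  refine ⟨fun N hN ↦ ⟨?_, ?_⟩, fun N _ N' _ h ↦ ?_, fun M hM ↦ ?_⟩
  · rintro _ (⟨e, he, rfl⟩ | ⟨i, rfl⟩)
    · exact Or.inl ⟨e, hN.1 he, rfl⟩
    · exact Or.inr ⟨i, Set.mem_univ i, rfl⟩
  · rintro _ (⟨x, hx, rfl⟩ | ⟨x, -, rfl⟩)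
    · obtain ⟨e, he, hex⟩ := hN.exists_inc hx
      refine ⟨.inl e, ⟨Or.inl ⟨e, he, rfl⟩, inc_disjointUnion_inl.2 ⟨e, rfl, hex⟩⟩, ?_⟩
      rintro g ⟨hg, hgx⟩
      obtain ⟨f, rfl, hfx⟩ := inc_disjointUnion_inl.1 hgx
      have hf : f ∈ N := by simpa using hg
      rw [hN.eq_of_inc hf he hfx hex]
    · exact ⟨.inr x.1, ⟨Or.inr ⟨_, rfl⟩, inc_disjointUnion_inr.2 rfl⟩,
        fun g hg ↦ inc_disjointUnion_inr.1 hg.2⟩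
  · ext e
    have := Set.ext_iff.1 h (.inl e)
    simpa using this
  · have hM : (disjointUnion S (copiesK2 q)).IsPerfectMatching M := hM
    have hinr : ∀ i : Fin q, (Sum.inr i : β ⊕ Fin q) ∈ M := by
      intro i
      obtain ⟨e, he, hei⟩ := hM.exists_inc
        (x := (Sum.inr (i, false) : α ⊕ (Fin q × Bool))) (Or.inr ⟨_, Set.mem_univ _, rfl⟩)
      rw [inc_disjointUnion_inr] at hei
      rwa [hei] at he
    refine ⟨Sum.inl ⁻¹' M, ⟨fun e he ↦ ?_, fun x hx ↦ ?_⟩, ?_⟩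
    · rcases hM.1 he with ⟨f, hf, h⟩ | ⟨f, -, h⟩
      · rwa [← Sum.inl_injective h]
      · exact (Sum.inr_ne_inl h).elim
    · obtain ⟨g, hg, hgx⟩ := hM.exists_inc
        (x := (Sum.inl x : α ⊕ (Fin q × Bool))) (Or.inl ⟨x, hx, rfl⟩)
      obtain ⟨e, rfl, hex⟩ := inc_disjointUnion_inl.1 hgx
      refine ⟨e, ⟨hg, hex⟩, fun f hf ↦ ?_⟩
      exact Sum.inl_injective (hM.eq_of_inc hf.1 hg (inc_disjointUnion_inl.2 ⟨f, rfl, hf.2⟩) hgx)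
    · ext g
      rcases g with e | i
      · simp
      · simpa using hinr i

theorem isMinimallyMatchable_disjointUnion_copiesK2 {k : ℕ} (hk : 1 ≤ k) (hS : S.IsTight k) :
    (disjointUnion S (copiesK2 q)).IsMinimallyMatchable k := by
  have hbij := bijOn_perfectMatchings_disjointUnion_copiesK2 S q
  rw [isMinimallyMatchable_iff, IsMatchable, ← hbij.encard_eq]
  refine ⟨hS.isMatchable, ?_⟩
  rintro _ (⟨e, he, rfl⟩ | ⟨i, -, rfl⟩)
  · rw [← hbij.encard_sep_eq (p := fun N ↦ e ∉ N) (by simp)]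
    exact hS.avoid_lt e he
  · rw [← hbij.encard_sep_eq (p := fun N ↦ False) (by simp)]
    simpa using Nat.pos_of_ne_zero (by omega)

/-- Perfect matchings containing `e` avoid any edge adjacent to `e`, so minimality at that edge
bounds their number. -/
theorem IsMinimallyMatchable.isTight_of_disjointUnion_copiesK2 {k : ℕ}
    (h : (disjointUnion S (copiesK2 q)).IsMinimallyMatchable k)
    (hS : ∀ e ∈ S.edgeSet, ∃ f x, f ≠ e ∧ S.Inc e x ∧ S.Inc f x) : S.IsTight k := by
  have hbij := bijOn_perfectMatchings_disjointUnion_copiesK2 S q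
  rw [isMinimallyMatchable_iff, IsMatchable, ← hbij.encard_eq] at h
  have havoid : ∀ e ∈ S.edgeSet, {M ∈ S.perfectMatchings | e ∉ M}.encard < k := by
    intro e he
    rw [hbij.encard_sep_eq (q := fun M ↦ Sum.inl e ∉ M) (by simp)]
    exact h.2 _ (Or.inl ⟨e, he, rfl⟩)
  refine ⟨h.1, havoid, fun e he ↦ ?_⟩
  obtain ⟨f, x, hfe, hex, hfx⟩ := hS e he
  refine (Set.encard_le_encard ?_).trans_lt (havoid f hfx.edge_mem)
  exact fun M hM ↦ ⟨hM.1, fun hf ↦ hfe (IsPerfectMatching.eq_of_inc hM.1 hf hM.2 hfx hex)⟩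

end CopiesK2

theorem Isomorphism.isMinimallyMatchable_iff {α β α' β' : Type*} {G : Graph α β}
    {G' : Graph α' β'} (φ : Isomorphism G G') (k : ℕ) :
    G.IsMinimallyMatchable k ↔ G'.IsMinimallyMatchable k := by
  have hbij := φ.bijOn_mapEdges
  have hsep : ∀ e : G.edgeSet, {M ∈ G.perfectMatchings | (e : β) ∉ M}.encard =
      {M ∈ G'.perfectMatchings | (φ.edgeEquiv e : β') ∉ M}.encard := fun e ↦
    hbij.encard_sep_eq fun M _ ↦ by rw [φ.mem_mapEdges]
  rw [Graph.isMinimallyMatchable_iff, Graph.isMinimallyMatchable_iff, IsMatchable, IsMatchable,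
    hbij.encard_eq]
  refine and_congr_right fun _ ↦ ⟨fun h g hg ↦ ?_, fun h e he ↦ ?_⟩
  · obtain ⟨e, he⟩ := φ.edgeEquiv.surjective ⟨g, hg⟩
    have h' := h e e.2
    rw [hsep, he] at h'
    exact h'
  · rw [hsep ⟨e, he⟩]
    exact h _ (φ.edgeEquiv ⟨e, he⟩).2

section Isolated

variable {α β : Type*}

/-- The edges that share no end with another edge. -/
def isolatedEdges (G : Graph α β) : Set β :=
  {e ∈ G.edgeSet | ∀ f x, G.Inc e x → G.Inc f x → f = e}

/-- The graph that remains when the isolated edges and their ends are deleted. -/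
def deleteIsolatedEdges (G : Graph α β) : Graph α β where
  vertexSet := {x ∈ G.vertexSet | ∀ e ∈ G.isolatedEdges, ¬ G.Inc e x}
  edgeSet := G.edgeSet \ G.isolatedEdges
  IsLink e x y := G.IsLink e x y ∧ e ∉ G.isolatedEdges
  isLink_symm _ _ := ⟨fun _ _ h ↦ ⟨h.1.symm, h.2⟩⟩
  eq_or_eq_of_isLink_of_isLink _ _ _ _ _ h h' := h.1.left_eq_or_eq h'.1
  edge_mem_iff_exists_isLink e := by
    constructor
    · rintro ⟨he, he'⟩
      obtain ⟨x, y, h⟩ := exists_isLink_of_mem_edgeSet he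
      exact ⟨x, y, h, he'⟩
    · rintro ⟨x, y, h, he'⟩
      exact ⟨h.edge_mem, he'⟩
  left_mem_of_isLink e x y h := ⟨h.1.left_mem, fun f hf hfx ↦ h.2 (by
    rwa [hf.2 e x hfx h.1.inc_left])⟩

theorem exists_adjacent_of_mem_deleteIsolatedEdges (G : Graph α β) :
    ∀ e ∈ G.deleteIsolatedEdges.edgeSet,
      ∃ f x, f ≠ e ∧ G.deleteIsolatedEdges.Inc e x ∧ G.deleteIsolatedEdges.Inc f x := by
  rintro e ⟨he, he'⟩
  simp only [isolatedEdges, Set.mem_ofPred_eq, not_and, not_forall] at he'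
  obtain ⟨f, x, hex, hfx, hfe⟩ := he' he
  have he'' : e ∉ G.isolatedEdges := fun h ↦ hfe (h.2 f x hex hfx)
  have hf'' : f ∉ G.isolatedEdges := fun h ↦ hfe (h.2 e x hfx hex).symm
  obtain ⟨y, hy⟩ := hex
  obtain ⟨z, hz⟩ := hfx
  exact ⟨f, x, hfe, ⟨y, hy, he''⟩, ⟨z, hz, hf''⟩⟩

theorem exists_isomorphism_disjointUnion_copiesK2 (G : Graph α β) (hG : G.IsFiniteLoopless) :
    ∃ q, Nonempty (Isomorphism G (disjointUnion G.deleteIsolatedEdges (copiesK2 q))) := by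
  have := hG.loopless
  have hfin : Finite G.isolatedEdges :=
    (hG.finite_edgeSet.subset (Set.sep_subset _ _)).to_subtype
  obtain ⟨q, ⟨i⟩⟩ := Finite.exists_equiv_fin G.isolatedEdges
  refine ⟨q, ⟨Isomorphism.symm ?_⟩⟩
  have hends : ∀ j : Fin q, ∃ v : Bool → α, G.IsLink (i.symm j) (v false) (v true) := by
    intro j
    obtain ⟨x, y, h⟩ := exists_isLink_of_mem_edgeSet (i.symm j).2.1
    exact ⟨fun b ↦ cond b y x, h⟩
  choose v hv using hends
  have hinc : ∀ j b, G.Inc (i.symm j) (v j b) := by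
    rintro j (_ | _)
    · exact (hv j).inc_left
    · exact (hv j).inc_right
  have hvinj : ∀ {j j' b b'}, v j b = v j' b' → j = j' ∧ b = b' := by
    intro j j' b b' h
    have h1 : i.symm j = i.symm j' :=
      Subtype.ext ((i.symm j').2.2 _ _ (hinc j' b') (h ▸ hinc j b))
    have h1 := i.symm.injective h1
    subst h1
    refine ⟨rfl, ?_⟩
    have hne := (hv j).ne
    cases b <;> cases b' <;> simp_all
  refine Isomorphism.ofBijOn (Sum.elim id fun z ↦ v z.1 z.2) (Sum.elim id fun j ↦ i.symm j)
    ⟨?_, ?_, ?_⟩ ⟨?_, ?_, ?_⟩ ?_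
  · rintro _ (⟨x, hx, rfl⟩ | ⟨z, -, rfl⟩)
    · exact hx.1
    · exact (hinc z.1 z.2).vertex_mem
  · rintro _ (⟨x, hx, rfl⟩ | ⟨z, -, rfl⟩) _ (⟨x', hx', rfl⟩ | ⟨z', -, rfl⟩) h
    · exact congrArg Sum.inl h
    · exact (hx.2 _ (i.symm z'.1).2 (show G.Inc _ x from (show x = _ from h) ▸ hinc z'.1 z'.2)).elim
    · exact (hx'.2 _ (i.symm z.1).2
        (show G.Inc _ x' from (show _ = x' from h) ▸ hinc z.1 z.2)).elim
    · exact congrArg Sum.inr (Prod.ext (hvinj h).1 (hvinj h).2)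
  · intro x hx
    by_cases hx' : ∃ e ∈ G.isolatedEdges, G.Inc e x
    · obtain ⟨e, he, hex⟩ := hx'
      have hl := hv (i ⟨e, he⟩)
      simp only [Equiv.symm_apply_apply] at hl
      rcases hex.eq_or_eq_of_isLink hl with rfl | rfl
      · exact ⟨.inr (i ⟨e, he⟩, false), Or.inr ⟨_, Set.mem_univ _, rfl⟩, rfl⟩
      · exact ⟨.inr (i ⟨e, he⟩, true), Or.inr ⟨_, Set.mem_univ _, rfl⟩, rfl⟩
    · push Not at hx'
      exact ⟨.inl x, Or.inl ⟨x, ⟨hx, hx'⟩, rfl⟩, rfl⟩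
  · rintro _ (⟨e, he, rfl⟩ | ⟨j, -, rfl⟩)
    · exact he.1
    · exact (i.symm j).2.1
  · rintro _ (⟨e, he, rfl⟩ | ⟨j, -, rfl⟩) _ (⟨e', he', rfl⟩ | ⟨j', -, rfl⟩) h
    · exact congrArg Sum.inl h
    · exact (he.2 ((show e = _ from h) ▸ (i.symm j').2)).elim
    · exact (he'.2 ((show _ = e' from h) ▸ (i.symm j).2)).elim
    · exact congrArg Sum.inr (i.symm.injective (Subtype.ext h))
  · intro e he
    by_cases he' : e ∈ G.isolatedEdges
    · exact ⟨.inr (i ⟨e, he'⟩), Or.inr ⟨_, Set.mem_univ _, rfl⟩, by simp⟩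
    · exact ⟨.inl e, Or.inl ⟨e, ⟨he, he'⟩, rfl⟩, rfl⟩
  · rintro _ (⟨e, he, rfl⟩ | ⟨j, -, rfl⟩) _ (⟨x, hx, rfl⟩ | ⟨⟨z, b⟩, -, rfl⟩) _
      (⟨y, hy, rfl⟩ | ⟨⟨w, c⟩, -, rfl⟩)
    · exact ⟨fun h ↦ h.1, fun h ↦ ⟨h, he.2⟩⟩
    -- An edge meeting an end of an isolated edge is that edge.
    · refine iff_of_false (fun h ↦ h) fun h ↦ he.2 ?_
      have h : G.IsLink e x (v w c) := h
      rw [(i.symm w).2.2 e _ (hinc w c) h.inc_right]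
      exact (i.symm w).2
    · refine iff_of_false (fun h ↦ h) fun h ↦ he.2 ?_
      have h : G.IsLink e (v z b) y := h
      rw [(i.symm z).2.2 e _ (hinc z b) h.inc_left]
      exact (i.symm z).2
    · refine iff_of_false (fun h ↦ h) fun h ↦ he.2 ?_
      have h : G.IsLink e (v z b) (v w c) := h
      rw [(i.symm w).2.2 e _ (hinc w c) h.inc_right]
      exact (i.symm w).2
    · exact iff_of_false (fun h ↦ h) fun h ↦ hx.2 _ (i.symm j).2 (IsLink.inc_left h)
    · exact iff_of_false (fun h ↦ h) fun h ↦ hx.2 _ (i.symm j).2 (IsLink.inc_left h)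
    · exact iff_of_false (fun h ↦ h) fun h ↦ hy.2 _ (i.symm j).2 (IsLink.inc_right h)
    · constructor
      · rintro ⟨h1, h2, h3⟩
        simp only at h1 h2 h3
        subst h1
        subst h2
        change G.IsLink (i.symm w) (v w b) (v w c)
        cases b <;> cases c <;> first | exact (h3 rfl).elim | exact hv w | exact (hv w).symm
      · intro h
        have h : G.IsLink (i.symm j) (v z b) (v w c) := h
        have hz : z = j := i.symm.injective
          (Subtype.ext ((i.symm j).2.2 _ _ h.inc_left (hinc z b)))
        have hw : w = j := i.symm.injective
          (Subtype.ext ((i.symm j).2.2 _ _ h.inc_right (hinc w c)))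
        subst hz
        subst hw
        exact ⟨rfl, rfl, fun hbc ↦ h.ne (by rw [show b = c from hbc])⟩

end Isolated

end Graph

/-! ### Lengthening and suppressing paths. -/

namespace Graph

section Lengthen

variable {α β α' β' : Type*} {H : Graph α β} {S S' : Graph α' β'}

/-- If `S` is obtained from `S'` by replacing the edge `e` by the path `f, e, g` through two new
vertices, then an odd subdivision `S'` of `H` yields an odd subdivision `S` of `H`. -/
theorem IsOddSubdivision.lengthen (hH : IsOddSubdivision H S') {u v w z : α'} {e f g : β'}
    (hV : ∀ x, x ∈ S.vertexSet ↔ x ∈ S'.vertexSet ∨ x = v ∨ x = w) (hv : v ∉ S'.vertexSet)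
    (hw : w ∉ S'.vertexSet) (hvw : v ≠ w)
    (hE : ∀ h, h ∈ S.edgeSet ↔ h ∈ S'.edgeSet ∨ h = f ∨ h = g) (hf : f ∉ S'.edgeSet)
    (hg : g ∉ S'.edgeSet) (hfg : f ≠ g)
    (hlink : ∀ h x y, h ≠ e → S'.IsLink h x y → S.IsLink h x y)
    (he : S'.IsLink e u z) (hfl : S.IsLink f u v) (hel : S.IsLink e v w) (hgl : S.IsLink g w z) :
    IsOddSubdivision H S := by
  classical
  obtain ⟨o⟩ := hH
  obtain ⟨e₀, j, hj, hej⟩ := o.edge_cover ⟨e, he.edge_mem⟩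
  have hej : (o.edge e₀ j : β') = e := congrArg Subtype.val hej
  -- The path of `o` may traverse `e` from `u` to `z` or backwards; the primed names follow its
  -- direction.
  obtain ⟨a, b, f', g', hf'l, hel', hg'l, hab⟩ : ∃ a b f' g',
      S.IsLink f' (o.vert e₀ j) a ∧ S.IsLink e a b ∧ S.IsLink g' b (o.vert e₀ (j + 1)) ∧
        ((a = v ∧ b = w ∧ f' = f ∧ g' = g) ∨ (a = w ∧ b = v ∧ f' = g ∧ g' = f)) := by
    have hl := o.isLink e₀ j hj
    rw [hej] at hl
    rcases hl.eq_and_eq_or_eq_and_eq he with ⟨h1, h2⟩ | ⟨h1, h2⟩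
    · exact ⟨v, w, f, g, h1 ▸ hfl, hel, h2 ▸ hgl, Or.inl ⟨rfl, rfl, rfl, rfl⟩⟩
    · exact ⟨w, v, g, f, h1 ▸ hgl.symm, hel.symm, h2 ▸ hfl.symm, Or.inr ⟨rfl, rfl, rfl, rfl⟩⟩
  have ha : a ∉ S'.vertexSet := by rcases hab with ⟨rfl, -⟩ | ⟨rfl, -⟩ <;> assumption
  have hb : b ∉ S'.vertexSet := by rcases hab with ⟨-, rfl, -⟩ | ⟨-, rfl, -⟩ <;> assumption
  have hf' : f' ∉ S'.edgeSet := by rcases hab with ⟨-, -, rfl, -⟩ | ⟨-, -, rfl, -⟩ <;> assumption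
  have hg' : g' ∉ S'.edgeSet := by rcases hab with ⟨-, -, -, rfl⟩ | ⟨-, -, -, rfl⟩ <;> assumption
  have habne : a ≠ b := by
    rcases hab with ⟨rfl, rfl, -⟩ | ⟨rfl, rfl, -⟩
    exacts [hvw, hvw.symm]
  have hfgne : f' ≠ g' := by
    rcases hab with ⟨-, -, rfl, rfl⟩ | ⟨-, -, rfl, rfl⟩
    exacts [hfg, hfg.symm]
  have hV' : ∀ x ∈ S.vertexSet, x ∈ S'.vertexSet ∨ x = a ∨ x = b := by
    intro x hx
    have := (hV x).1 hx
    rcases hab with ⟨rfl, rfl, -⟩ | ⟨rfl, rfl, -⟩ <;> tauto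
  have hE' : ∀ h ∈ S.edgeSet, h ∈ S'.edgeSet ∨ h = f' ∨ h = g' := by
    intro x hx
    have := (hE x).1 hx
    rcases hab with ⟨-, -, rfl, rfl⟩ | ⟨-, -, rfl, rfl⟩ <;> tauto
  let ιV : S'.vertexSet → S.vertexSet := fun x ↦ ⟨x, (hV x).2 (Or.inl x.2)⟩
  let ιE : S'.edgeSet → S.edgeSet := fun x ↦ ⟨x, (hE x).2 (Or.inl x.2)⟩
  have ιVinj : Function.Injective ιV := fun x y h ↦ Subtype.ext (Subtype.ext_iff.1 h :)
  have ιEinj : Function.Injective ιE := fun x y h ↦ Subtype.ext (Subtype.ext_iff.1 h :)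
  obtain ⟨A, hA⟩ : ∃ A : S.vertexSet, (A : α') = a := ⟨⟨a, hel'.left_mem⟩, rfl⟩
  obtain ⟨B, hB⟩ : ∃ B : S.vertexSet, (B : α') = b := ⟨⟨b, hel'.right_mem⟩, rfl⟩
  obtain ⟨F, hF⟩ : ∃ F : S.edgeSet, (F : β') = f' := ⟨⟨f', hf'l.edge_mem⟩, rfl⟩
  obtain ⟨K, hK⟩ : ∃ K : S.edgeSet, (K : β') = g' := ⟨⟨g', hg'l.edge_mem⟩, rfl⟩
  have hιA : ∀ x, ιV x ≠ A := fun x h ↦ ha (by rw [← hA, ← h]; exact x.2)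
  have hιB : ∀ x, ιV x ≠ B := fun x h ↦ hb (by rw [← hB, ← h]; exact x.2)
  have hιF : ∀ x, ιE x ≠ F := fun x h ↦ hf' (by rw [← hF, ← h]; exact x.2)
  have hιK : ∀ x, ιE x ≠ K := fun x h ↦ hg' (by rw [← hK, ← h]; exact x.2)
  have hAB : A ≠ B := fun h ↦ habne (by rw [← hA, ← hB, h])
  have hFK : F ≠ K := fun h ↦ hfgne (by rw [← hF, ← hK, h])
  let len : H.edgeSet → ℕ := fun d ↦ if d = e₀ then o.length d + 2 else o.length d
  -- Only the path of `e₀` changes: the new vertices take positions `j + 1` and `j + 2`, and later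
  -- ones shift by two. The edge `e` moves from index `j` to `j + 1`.
  let vert : H.edgeSet → ℕ → S.vertexSet := fun d i ↦
    if d = e₀ then (if i ≤ j then ιV (o.vert d i) else if i = j + 1 then A else
      if i = j + 2 then B else ιV (o.vert d (i - 2))) else ιV (o.vert d i)
  let edge : H.edgeSet → ℕ → S.edgeSet := fun d i ↦
    if d = e₀ then (if i < j then ιE (o.edge d i) else if i = j then F else
      if i = j + 1 then ιE (o.edge d j) else if i = j + 2 then K else ιE (o.edge d (i - 2)))
      else ιE (o.edge d i)
  have len₀ : len e₀ = o.length e₀ + 2 := if_pos rfl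
  have len_ne : ∀ d, d ≠ e₀ → len d = o.length d := fun d hd ↦ if_neg hd
  -- Each position is new or comes from an old position that determines it; injectivity is inherited
  -- in this way.
  have vdesc : ∀ d i, 0 < i → i < len d → (d = e₀ ∧ i = j + 1 ∧ vert d i = A) ∨
      (d = e₀ ∧ i = j + 2 ∧ vert d i = B) ∨
      ∃ i', 0 < i' ∧ i' < o.length d ∧ vert d i = ιV (o.vert d i') ∧
        i = if d = e₀ ∧ j < i' then i' + 2 else i' := by
    intro d i hi hil
    by_cases hd : d = e₀
    · subst hd
      rw [len₀] at hil
      rcases lt_or_ge j i with hji | hji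
      · by_cases h1 : i = j + 1
        · subst h1
          exact Or.inl ⟨rfl, rfl, by simp [vert]⟩
        by_cases h2 : i = j + 2
        · subst h2
          exact Or.inr (Or.inl ⟨rfl, rfl, by simp [vert]⟩)
        refine Or.inr (Or.inr ⟨i - 2, by omega, by omega, ?_, ?_⟩)
        · simp [vert, h1, h2, not_le.2 hji]
        · rw [if_pos ⟨rfl, by omega⟩]
          omega
      · refine Or.inr (Or.inr ⟨i, by omega, by omega, by simp [vert, hji], ?_⟩)
        rw [if_neg (by omega)]
    · rw [len_ne d hd] at hil
      exact Or.inr (Or.inr ⟨i, hi, hil, by simp [vert, hd], by simp [hd]⟩)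
  have edesc : ∀ d i, i < len d → (d = e₀ ∧ i = j ∧ edge d i = F) ∨
      (d = e₀ ∧ i = j + 2 ∧ edge d i = K) ∨
      ∃ i', i' < o.length d ∧ edge d i = ιE (o.edge d i') ∧
        i = if d = e₀ then (if i' < j then i' else if i' = j then j + 1 else i' + 2) else i' := by
    intro d i hil
    by_cases hd : d = e₀
    · subst hd
      rw [len₀] at hil
      rcases lt_or_ge i j with hji | hji
      · exact Or.inr (Or.inr ⟨i, by omega, by simp [edge, hji], by simp [hji]⟩)
      by_cases h0 : i = j
      · subst h0
        exact Or.inl ⟨rfl, rfl, by simp [edge]⟩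
      by_cases h1 : i = j + 1
      · subst h1
        exact Or.inr (Or.inr ⟨j, hj, by simp [edge], by simp⟩)
      by_cases h2 : i = j + 2
      · subst h2
        exact Or.inr (Or.inl ⟨rfl, rfl, by simp [edge]⟩)
      refine Or.inr (Or.inr ⟨i - 2, by omega, ?_, ?_⟩)
      · simp [edge, h0, h1, h2, not_lt.2 hji]
      · rw [if_pos rfl, if_neg (by omega), if_neg (by omega)]
        omega
    · rw [len_ne d hd] at hil
      exact Or.inr (Or.inr ⟨i, hil, by simp [edge, hd], by simp [hd]⟩)
  have hlink' : ∀ d i, i < o.length d → (d ≠ e₀ ∨ i ≠ j) →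
      S.IsLink (ιE (o.edge d i)) (ιV (o.vert d i)) (ιV (o.vert d (i + 1))) := by
    intro d i hi hne
    refine hlink _ _ _ (fun h ↦ ?_) (o.isLink d i hi)
    have := o.edge_injective d i e₀ j hi hj (Subtype.ext (h.trans hej.symm))
    tauto
  refine ⟨{
    branch := o.branch.trans ⟨ιV, ιVinj⟩
    length := len
    vert := vert
    edge := edge
    odd_length := ?_
    ends := ?_
    isLink := ?_
    internal_ne_branch := ?_
    internal_injective := ?_
    edge_injective := ?_
    vert_cover := ?_
    edge_cover := ?_ }⟩
  · intro d
    have := o.odd_length d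
    simp only [len]
    split_ifs
    · rw [Nat.odd_iff] at this ⊢
      omega
    · exact this
  · intro d
    obtain ⟨x, y, hxy, hx, hy⟩ := o.ends d
    refine ⟨x, y, hxy, ?_, ?_⟩
    · have : vert d 0 = ιV (o.vert d 0) := by simp [vert]
      rw [this, hx]
      rfl
    · have : vert d (len d) = ιV (o.vert d (o.length d)) := by
        by_cases hd : d = e₀
        · subst hd
          have h1 : ¬ o.length d + 2 ≤ j := by omega
          have h2 : o.length d + 2 ≠ j + 1 := by omega
          have h3 : o.length d ≠ j := by omega
          rw [len₀]
          simp [vert, h1, h3]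
          omega
        · rw [len_ne d hd]
          simp [vert, hd]
      rw [this, hy]
      rfl
  · intro d i hi
    by_cases hd : d = e₀
    · subst hd
      rw [len₀] at hi
      rcases lt_or_ge i j with hij | hij
      · have h1 : edge d i = ιE (o.edge d i) := by simp [edge, hij]
        have h2 : vert d i = ιV (o.vert d i) := by simp [vert, hij.le]
        have h3 : vert d (i + 1) = ιV (o.vert d (i + 1)) := by simp [vert, Nat.succ_le_of_lt hij]
        rw [h1, h2, h3]
        exact hlink' d i (by omega) (Or.inr (by omega))
      by_cases h0 : i = j
      · subst h0
        have h1 : edge d i = F := by simp [edge]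
        have h2 : vert d i = ιV (o.vert d i) := by simp [vert]
        have h3 : vert d (i + 1) = A := by simp [vert]
        rw [h1, h2, h3, hF, hA]
        exact hf'l
      by_cases h0 : i = j + 1
      · subst h0
        have h1 : edge d (j + 1) = ιE (o.edge d j) := by simp [edge]
        have h2 : vert d (j + 1) = A := by simp [vert]
        have h3 : vert d (j + 1 + 1) = B := by simp [vert]
        rw [h1, h2, h3, hA, hB]
        change S.IsLink (o.edge d j) a b
        rw [hej]
        exact hel'
      by_cases h0 : i = j + 2
      · subst h0
        have h1 : edge d (j + 2) = K := by simp [edge]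
        have h2 : vert d (j + 2) = B := by simp [vert]
        have h3 : vert d (j + 2 + 1) = ιV (o.vert d (j + 1)) := by simp [vert, add_assoc]
        rw [h1, h2, h3, hK, hB]
        exact hg'l
      obtain ⟨i', rfl⟩ : ∃ i', i = i' + 2 := ⟨i - 2, by omega⟩
      have c1 : ¬ i' + 2 < j := by omega
      have c2 : i' + 2 ≠ j := by omega
      have c3 : i' + 2 ≠ j + 1 := by omega
      have c4 : i' + 2 ≠ j + 2 := by omega
      have c5 : ¬ i' + 2 ≤ j := by omega
      have c6 : ¬ i' + 2 + 1 ≤ j := by omega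
      have c7 : i' + 2 + 1 ≠ j + 1 := by omega
      have c8 : i' + 2 + 1 ≠ j + 2 := by omega
      have h1 : edge d (i' + 2) = ιE (o.edge d i') := by
        simp only [edge, if_true, if_neg c1, if_neg c2, if_neg c3, if_neg c4, Nat.add_sub_cancel]
      have h2 : vert d (i' + 2) = ιV (o.vert d i') := by
        simp only [vert, if_true, if_neg c5, if_neg c3, if_neg c4, Nat.add_sub_cancel]
      have h3 : vert d (i' + 2 + 1) = ιV (o.vert d (i' + 1)) := by
        simp only [vert, if_true, if_neg c6, if_neg c7, if_neg c8,
          show i' + 2 + 1 - 2 = i' + 1 by omega]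
      rw [h1, h2, h3]
      exact hlink' d i' (by omega) (Or.inr (by omega))
    · rw [len_ne d hd] at hi
      have h1 : edge d i = ιE (o.edge d i) := by simp [edge, hd]
      have h2 : ∀ i, vert d i = ιV (o.vert d i) := by simp [vert, hd]
      rw [h1, h2, h2]
      exact hlink' d i hi (Or.inl hd)
  · intro d i hi hil x hx
    have hx : vert d i = ιV (o.branch x) := hx
    rcases vdesc d i hi hil with ⟨-, -, h⟩ | ⟨-, -, h⟩ | ⟨i', h1, h2, h, -⟩
    · exact hιA _ (hx.symm.trans h)
    · exact hιB _ (hx.symm.trans h)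
    · exact o.internal_ne_branch d i' h1 h2 x (ιVinj (h.symm.trans hx))
  · intro d i d' i' hi hil hi' hil' h
    rcases vdesc d i hi hil with ⟨h1, h2, h3⟩ | ⟨h1, h2, h3⟩ | ⟨k, h1, h2, h3, h4⟩ <;>
      rcases vdesc d' i' hi' hil' with ⟨h1', h2', h3'⟩ | ⟨h1', h2', h3'⟩ | ⟨k', h1', h2', h3', h4'⟩ <;>
      rw [h3, h3'] at h
    · exact ⟨h1.trans h1'.symm, h2.trans h2'.symm⟩
    · exact (hAB h).elim
    · exact (hιA _ h.symm).elim
    · exact (hAB h.symm).elim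
    · exact ⟨h1.trans h1'.symm, h2.trans h2'.symm⟩
    · exact (hιB _ h.symm).elim
    · exact (hιA _ h).elim
    · exact (hιB _ h).elim
    · obtain ⟨rfl, rfl⟩ := o.internal_injective d k d' k' h1 h2 h1' h2' (ιVinj h)
      exact ⟨rfl, h4.trans h4'.symm⟩
  · intro d i d' i' hil hil' h
    rcases edesc d i hil with ⟨h1, h2, h3⟩ | ⟨h1, h2, h3⟩ | ⟨k, h2, h3, h4⟩ <;>
      rcases edesc d' i' hil' with ⟨h1', h2', h3'⟩ | ⟨h1', h2', h3'⟩ | ⟨k', h2', h3', h4'⟩ <;>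
      rw [h3, h3'] at h
    · exact ⟨h1.trans h1'.symm, h2.trans h2'.symm⟩
    · exact (hFK h).elim
    · exact (hιF _ h.symm).elim
    · exact (hFK h.symm).elim
    · exact ⟨h1.trans h1'.symm, h2.trans h2'.symm⟩
    · exact (hιK _ h.symm).elim
    · exact (hιF _ h).elim
    · exact (hιK _ h).elim
    · obtain ⟨rfl, rfl⟩ := o.edge_injective d k d' k' h2 h2' (ιEinj h)
      exact ⟨rfl, h4.trans h4'.symm⟩
  · intro x
    rcases hV' x x.2 with hx | hx | hx
    · rcases o.vert_cover ⟨x, hx⟩ with ⟨y, hy⟩ | ⟨d, i, hi, hil, hdi⟩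
      · exact Or.inl ⟨y, Subtype.ext (Subtype.ext_iff.1 hy :)⟩
      · have hx' : x = ιV (o.vert d i) := Subtype.ext (Subtype.ext_iff.1 hdi.symm :)
        refine Or.inr ⟨d, if d = e₀ ∧ j < i then i + 2 else i, ?_⟩
        by_cases hd : d = e₀
        · subst hd
          rw [len₀]
          rcases lt_or_ge j i with hji | hji
          · rw [if_pos ⟨rfl, hji⟩]
            refine ⟨by omega, by omega, ?_⟩
            have c1 : ¬ i + 2 ≤ j := by omega
            have c2 : i + 2 ≠ j + 1 := by omega
            have c3 : i + 2 ≠ j + 2 := by omega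
            simp only [vert, if_true, if_neg c1, if_neg c2, if_neg c3, Nat.add_sub_cancel, hx']
          · rw [if_neg (by omega)]
            exact ⟨hi, by omega, by simp [vert, hji, hx']⟩
        · rw [if_neg (by tauto), len_ne d hd]
          exact ⟨hi, hil, by simp [vert, hd, hx']⟩
    · refine Or.inr ⟨e₀, j + 1, by omega, by rw [len₀]; omega, ?_⟩
      exact (by simp [vert] : vert e₀ (j + 1) = A).trans (Subtype.ext (hA.trans hx.symm))
    · refine Or.inr ⟨e₀, j + 2, by omega, by rw [len₀]; omega, ?_⟩
      exact (by simp [vert] : vert e₀ (j + 2) = B).trans (Subtype.ext (hB.trans hx.symm))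
  · intro x
    rcases hE' x x.2 with hx | hx | hx
    · obtain ⟨d, i, hil, hdi⟩ := o.edge_cover ⟨x, hx⟩
      have hx' : x = ιE (o.edge d i) := Subtype.ext (Subtype.ext_iff.1 hdi.symm :)
      by_cases hd : d = e₀
      · subst hd
        rcases lt_trichotomy i j with hij | rfl | hij
        · exact ⟨d, i, by rw [len₀]; omega, by simp [edge, hij, hx']⟩
        · exact ⟨d, i + 1, by rw [len₀]; omega, by simp [edge, hx']⟩
        · refine ⟨d, i + 2, by rw [len₀]; omega, ?_⟩
          have c1 : ¬ i + 2 < j := by omega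
          have c2 : i + 2 ≠ j := by omega
          have c3 : i + 2 ≠ j + 1 := by omega
          have c4 : i + 2 ≠ j + 2 := by omega
          simp only [edge, if_true, if_neg c1, if_neg c2, if_neg c3, if_neg c4,
            Nat.add_sub_cancel, hx']
      · exact ⟨d, i, by rwa [len_ne d hd], by simp [edge, hd, hx']⟩
    · refine ⟨e₀, j, by rw [len₀]; omega, ?_⟩
      exact (by simp [edge] : edge e₀ j = F).trans (Subtype.ext (hF.trans hx.symm))
    · refine ⟨e₀, j + 2, by rw [len₀]; omega, ?_⟩
      exact (by simp [edge] : edge e₀ (j + 2) = K).trans (Subtype.ext (hK.trans hx.symm))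

/-- A graph is an odd subdivision of every graph isomorphic to it. -/
theorem Isomorphism.isOddSubdivision {G : Graph α β} {G' : Graph α' β'} (φ : Isomorphism G G') :
    IsOddSubdivision G G' := by
  have hends : ∀ e : G.edgeSet, ∃ v : Bool → G.vertexSet, G.IsLink e (v false) (v true) := by
    intro e
    obtain ⟨x, y, h⟩ := exists_isLink_of_mem_edgeSet e.2
    exact ⟨fun b ↦ cond b ⟨y, h.right_mem⟩ ⟨x, h.left_mem⟩, h⟩
  choose v hv using hends
  exact ⟨{
    branch := φ.vertexEquiv.toEmbedding
    length := fun _ ↦ 1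
    vert := fun e i ↦ φ.vertexEquiv (v e (i != 0))
    edge := fun e _ ↦ φ.edgeEquiv e
    odd_length := fun _ ↦ odd_one
    ends := fun e ↦ ⟨_, _, hv e, rfl, rfl⟩
    isLink := fun e i hi ↦ by
      obtain rfl : i = 0 := by omega
      exact (φ.isLink_iff _ _ _).1 (hv e)
    internal_ne_branch := fun e i h0 h1 ↦ by omega
    internal_injective := fun e i f j h0 h1 ↦ by omega
    edge_injective := fun e i f j hi hj h ↦ ⟨φ.edgeEquiv.injective h, by omega⟩
    vert_cover := fun z ↦ Or.inl (φ.vertexEquiv.surjective z)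
    edge_cover := fun g ↦ by
      obtain ⟨e, he⟩ := φ.edgeEquiv.surjective g
      exact ⟨e, 0, one_pos, he⟩ }⟩

end Lengthen

section Suppress

variable {α β : Type*} {S : Graph α β} {u v w z : α} {e f g : β}

/-- A path `u, f, v, e, w, g, z` whose inner vertices have degree two and whose ends differ. -/
structure IsSuppressiblePath (S : Graph α β) (u v w z : α) (e f g : β) : Prop where
  link_left : S.IsLink f u v
  link_mid : S.IsLink e v w
  link_right : S.IsLink g w z
  inc_left : ∀ h, S.Inc h v → h = e ∨ h = f
  inc_right : ∀ h, S.Inc h w → h = e ∨ h = g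
  left_ne_mid : f ≠ e
  right_ne_mid : g ≠ e
  left_ne_right : f ≠ g
  ends_ne : u ≠ z

/-- The graph in which a suppressible path is replaced by a single edge. -/
def IsSuppressiblePath.suppress [S.Loopless] (p : S.IsSuppressiblePath u v w z e f g) :
    Graph α β where
  vertexSet := S.vertexSet \ {v, w}
  edgeSet := S.edgeSet \ {f, g}
  IsLink h x y := (h = e ∧ ((x = u ∧ y = z) ∨ (x = z ∧ y = u))) ∨
    (h ≠ e ∧ h ≠ f ∧ h ≠ g ∧ S.IsLink h x y)
  isLink_symm _ _ := ⟨fun x y h ↦ by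
    rcases h with h | ⟨h1, h2, h3, h4⟩
    · exact Or.inl (by tauto)
    · exact Or.inr ⟨h1, h2, h3, h4.symm⟩⟩
  eq_or_eq_of_isLink_of_isLink h x y x' y' h1 h2 := by
    rcases h1 with h1 | h1 <;> rcases h2 with h2 | h2
    · grind
    · exact (h2.1 h1.1).elim
    · exact (h1.1 h2.1).elim
    · exact h1.2.2.2.left_eq_or_eq h2.2.2.2
  edge_mem_iff_exists_isLink h := by
    constructor
    · rintro ⟨hS, hfg⟩
      simp only [Set.mem_insert_iff, Set.mem_singleton_iff, not_or] at hfg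
      by_cases he : h = e
      · exact ⟨u, z, Or.inl ⟨he, Or.inl ⟨rfl, rfl⟩⟩⟩
      · obtain ⟨x, y, hxy⟩ := exists_isLink_of_mem_edgeSet hS
        exact ⟨x, y, Or.inr ⟨he, hfg.1, hfg.2, hxy⟩⟩
    · rintro ⟨x, y, ⟨rfl, -⟩ | ⟨h1, h2, h3, h4⟩⟩
      · exact ⟨p.link_mid.edge_mem, by simp [p.left_ne_mid.symm, p.right_ne_mid.symm]⟩
      · exact ⟨h4.edge_mem, by simp [h2, h3]⟩
  left_mem_of_isLink h x y hxy := by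
    -- Otherwise `f` would be a third edge at `w`.
    have huw : u ≠ w := by
      rintro rfl
      rcases p.inc_right f p.link_left.inc_left with h | h
      exacts [p.left_ne_mid h, p.left_ne_right h]
    have hzv : z ≠ v := by
      rintro rfl
      rcases p.inc_left g p.link_right.inc_right with h | h
      exacts [p.right_ne_mid h, p.left_ne_right h.symm]
    rcases hxy with ⟨rfl, ⟨rfl, rfl⟩ | ⟨rfl, rfl⟩⟩ | ⟨h1, h2, h3, h4⟩
    · exact ⟨p.link_left.left_mem, by simp [huw, p.link_left.ne]⟩
    · exact ⟨p.link_right.right_mem, by simp [hzv, p.link_right.ne.symm]⟩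
    · refine ⟨h4.left_mem, ?_⟩
      rintro (rfl | rfl)
      · rcases p.inc_left h h4.inc_left with h | h
        exacts [h1 h, h2 h]
      · rcases p.inc_right h h4.inc_left with h | h
        exacts [h1 h, h3 h]

theorem IsSuppressiblePath.isFiniteLoopless_suppress [S.Loopless]
    (p : S.IsSuppressiblePath u v w z e f g) (hS : S.IsFiniteLoopless) :
    p.suppress.IsFiniteLoopless where
  finite_vertexSet := hS.finite_vertexSet.subset Set.sdiff_subset
  finite_edgeSet := hS.finite_edgeSet.subset Set.sdiff_subset
  loopless := ⟨fun h x hx ↦ by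
    rcases hx with ⟨-, ⟨h1, h2⟩ | ⟨h1, h2⟩⟩ | ⟨-, -, -, h4⟩
    · exact p.ends_ne (h1.symm.trans h2)
    · exact p.ends_ne (h2.symm.trans h1)
    · exact h4.ne rfl⟩

theorem IsSuppressiblePath.isOddSubdivision [S.Loopless] {α' β' : Type*} {H : Graph α' β'}
    (p : S.IsSuppressiblePath u v w z e f g) (hH : IsOddSubdivision H p.suppress) :
    IsOddSubdivision H S := by
  refine hH.lengthen (u := u) (z := z) (v := v) (w := w) (e := e) (f := f) (g := g)
    (fun x ↦ ?_) (fun h ↦ h.2 (by simp)) (fun h ↦ h.2 (by simp)) p.link_mid.ne (fun h ↦ ?_)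
    (fun h ↦ h.2 (by simp)) (fun h ↦ h.2 (by simp)) p.left_ne_right ?_
    (Or.inl ⟨rfl, Or.inl ⟨rfl, rfl⟩⟩) p.link_left p.link_mid p.link_right
  · have h1 := p.link_mid.left_mem
    have h2 := p.link_mid.right_mem
    constructor
    · intro hx
      by_cases hxv : x = v ∨ x = w
      · exact Or.inr hxv
      · exact Or.inl ⟨hx, hxv⟩
    · rintro (hx | rfl | rfl)
      exacts [hx.1, h1, h2]
  · have h1 := p.link_left.edge_mem
    have h2 := p.link_right.edge_mem
    constructor
    · intro hx
      by_cases hxv : h = f ∨ h = g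
      · exact Or.inr hxv
      · exact Or.inl ⟨hx, hxv⟩
    · rintro (hx | rfl | rfl)
      exacts [hx.1, h1, h2]
  · rintro h x y hne (hxy | hxy)
    · exact (hne hxy.1).elim
    · exact hxy.2.2.2

end Suppress

end Graph

/-! ### Size of tight graphs without suppressible paths. -/

theorem Set.ncard_le_mul_of_subset_iUnion {ι α : Type*} [Fintype ι] {A : Set α} {s : ι → Set α}
    {n c : ℕ} (hA : A ⊆ ⋃ i, s i) (hfin : ∀ i, (s i).Finite) (hn : Fintype.card ι ≤ n)
    (hc : ∀ i, (s i).ncard ≤ c) : A.ncard ≤ n * c := by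
  calc A.ncard ≤ (⋃ i, s i).ncard := Set.ncard_le_ncard hA (Set.finite_iUnion hfin)
    _ ≤ ∑ i, (s i).ncard := Set.ncard_iUnion_le_of_fintype s
    _ ≤ ∑ _i : ι, c := Finset.sum_le_sum fun i _ ↦ hc i
    _ = Fintype.card ι * c := by simp
    _ ≤ n * c := Nat.mul_le_mul_right c hn

namespace Graph

variable {α β : Type*} {S : Graph α β} {k : ℕ}

theorem IsTight.exists_mem (hS : S.IsTight k) {e : β} (he : e ∈ S.edgeSet) :
    ∃ M, S.IsPerfectMatching M ∧ e ∈ M := by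
  by_contra! h
  refine (hS.avoid_lt e he).not_ge (hS.isMatchable.trans (Set.encard_le_encard fun M hM ↦ ?_))
  exact ⟨hM, h M hM⟩

theorem IsTight.exists_ne_inc (hS : S.IsTight k) {e : β} {x : α} (he : S.Inc e x) :
    ∃ f ≠ e, S.Inc f x := by
  by_contra! h
  refine (hS.contain_lt e he.edge_mem).not_ge
    (hS.isMatchable.trans (Set.encard_le_encard fun M hM ↦ ⟨hM, ?_⟩))
  obtain ⟨f, hf, hfx⟩ := IsPerfectMatching.exists_inc hM he.vertex_mem
  by_cases hfe : f = e
  · rwa [← hfe]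
  · exact (h f hfe hfx).elim

/-- For any one edge, the matchings are those containing it and those avoiding it. -/
theorem IsTight.ncard_perfectMatchings_le (hS : S.IsTight k) (hk : 1 ≤ k)
    (hne : S.vertexSet.Nonempty) : S.perfectMatchings.ncard ≤ 2 * k := by
  obtain ⟨x, hx⟩ := hne
  obtain ⟨M, hM⟩ : S.perfectMatchings.Nonempty := by
    rw [← Set.encard_pos]
    exact lt_of_lt_of_le (by exact_mod_cast hk) hS.isMatchable
  obtain ⟨e, -, hex⟩ := IsPerfectMatching.exists_inc hM hx
  have hsub : S.perfectMatchings ⊆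
      {M ∈ S.perfectMatchings | e ∈ M} ∪ {M ∈ S.perfectMatchings | e ∉ M} := by
    intro M hM
    by_cases he : e ∈ M
    · exact Or.inl ⟨hM, he⟩
    · exact Or.inr ⟨hM, he⟩
  have hle : S.perfectMatchings.encard ≤ ((2 * k : ℕ) : ℕ∞) := by
    refine (Set.encard_le_encard hsub).trans ((Set.encard_union_le _ _).trans ?_)
    rw [two_mul, Nat.cast_add]
    exact add_le_add (hS.contain_lt e hex.edge_mem).le (hS.avoid_lt e hex.edge_mem).le
  exact ENat.toNat_le_of_le_natCast hle

/-- The vertices with at least three edges. -/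
def branchVertices (S : Graph α β) : Set α :=
  {x | ∃ e : Fin 3 → β, Function.Injective e ∧ ∀ i, S.Inc (e i) x}

/-- The vertices of the components that consist of two vertices joined by two edges. -/
def multiEdgeVertices (S : Graph α β) : Set α :=
  {x | ∃ w e f, e ≠ f ∧ S.IsLink e x w ∧ S.IsLink f x w ∧
    (∀ h, S.Inc h x → h = e ∨ h = f) ∧ ∀ h, S.Inc h w → h = e ∨ h = f}

/-- Perfect matchings through three different edges at a vertex make it rainbow; there are at most
`n ^ 3` triples. -/
theorem ncard_branchVertices_le [S.Loopless] (hV : S.vertexSet.Finite) (hE : S.edgeSet.Finite)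
    (hS : S.IsTight k) {n : ℕ} (hn : S.perfectMatchings.ncard ≤ n) :
    S.branchVertices.ncard ≤ n ^ 3 * (5 * 3 ^ n) := by
  classical
  have hPM := finite_perfectMatchings hE
  have := hPM.fintype
  refine Set.ncard_le_mul_of_subset_iUnion
    (s := fun M : Fin 3 → S.perfectMatchings ↦ S.rainbow fun i ↦ M i) ?_
    (fun M ↦ hV.subset (Set.sep_subset _ _)) ?_ fun M ↦ ?_
  · rintro x ⟨e, he, hex⟩
    choose M hM heM using fun i ↦ hS.exists_mem (hex i).edge_mem
    refine Set.mem_iUnion.2 ⟨fun i ↦ ⟨M i, hM i⟩, (hex 0).vertex_mem, fun g hg i j hi hj ↦ he ?_⟩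
    rw [(hM i).eq_of_inc (heM i) hi (hex i) hg, (hM j).eq_of_inc (heM j) hj (hex j) hg]
  · rw [Fintype.card_fun, Fintype.card_fin, ← Nat.card_eq_fintype_card]
    exact Nat.pow_le_pow_left hn 3
  · exact ncard_rainbow_le hV hE n (fun i ↦ (M i).2)
      ((Set.ncard_le_ncard (Set.sep_subset _ _) hPM).trans hn)

/-- Every edge lies in a perfect matching, so a neighbour of `y` is the mate of `y` in one of at
most `n` matchings. -/
theorem ncard_neighbours_le (hE : S.edgeSet.Finite)
    (hS : S.IsTight k) {n : ℕ} (hn : S.perfectMatchings.ncard ≤ n) {W : Set α} (hW : W.Finite) :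
    {x | ∃ y ∈ W, S.Adj x y}.ncard ≤ n * W.ncard := by
  classical
  have hPM := finite_perfectMatchings hE
  have := hPM.fintype
  have hmate : ∀ (M : S.perfectMatchings) y, ∃ x, ∀ e ∈ (M : Set β), ∀ z, S.IsLink e z y → z = x := by
    intro M y
    by_cases hy : y ∈ S.vertexSet
    · obtain ⟨e, he, x, hx⟩ := IsPerfectMatching.exists_inc M.2 hy
      refine ⟨x, fun f hf z hz ↦ ?_⟩
      obtain rfl := IsPerfectMatching.eq_of_inc M.2 hf he hz.inc_right hx.inc_left
      exact hz.left_unique hx.symm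
    · exact ⟨y, fun e _ z hz ↦ (hy hz.right_mem).elim⟩
  choose m hm using hmate
  refine Set.ncard_le_mul_of_subset_iUnion (s := fun M ↦ m M '' W) ?_ (fun M ↦ hW.image _)
    (by rwa [← Nat.card_eq_fintype_card]) fun M ↦ Set.ncard_image_le hW
  rintro x ⟨y, hy, e, he⟩
  obtain ⟨M, hM, heM⟩ := hS.exists_mem he.edge_mem
  exact Set.mem_iUnion.2 ⟨⟨M, hM⟩, y, hy, (hm ⟨M, hM⟩ y e heM x he).symm⟩

theorem ncard_edgeSet_le (hV : S.vertexSet.Finite) (hE : S.edgeSet.Finite)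
    (hS : S.IsTight k) {n : ℕ} (hn : S.perfectMatchings.ncard ≤ n) :
    S.edgeSet.ncard ≤ n * S.vertexSet.ncard := by
  classical
  have hPM := finite_perfectMatchings hE
  have := hPM.fintype
  have hedge : ∀ (M : S.perfectMatchings) (y : S.vertexSet), ∃ e, ∀ f ∈ (M : Set β),
      S.Inc f y → f = e := by
    intro M y
    obtain ⟨e, he, hey⟩ := IsPerfectMatching.exists_inc M.2 y.2
    exact ⟨e, fun f hf hfy ↦ IsPerfectMatching.eq_of_inc M.2 hf he hfy hey⟩
  choose m hm using hedge
  have := hV.fintype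
  refine Set.ncard_le_mul_of_subset_iUnion (s := fun M ↦ Set.range (m M)) ?_
    (fun M ↦ Set.finite_range _) (by rwa [← Nat.card_eq_fintype_card]) fun M ↦ ?_
  · intro e he
    obtain ⟨M, hM, heM⟩ := hS.exists_mem he
    obtain ⟨x, y, hxy⟩ := exists_isLink_of_mem_edgeSet he
    exact Set.mem_iUnion.2 ⟨⟨M, hM⟩, ⟨x, hxy.left_mem⟩,
      (hm ⟨M, hM⟩ ⟨x, hxy.left_mem⟩ e heM hxy.inc_left).symm⟩
  · rw [← Set.image_univ, ← Nat.card_coe_set_eq S.vertexSet, ← Set.ncard_univ]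
    exact Set.ncard_image_le Set.finite_univ

/-- The edges at `x` are the two parallel edges of its component, and this exchanges them. -/
theorem isPerfectMatching_symmDiff_of_mem_multiEdgeVertices {M : Set β}
    (hM : S.IsPerfectMatching M) {x : α} (hx : x ∈ S.multiEdgeVertices) :
    S.IsPerfectMatching (symmDiff M {h | S.Inc h x}) := by
  obtain ⟨w, e, f, hef, he, hf, hxi, hwi⟩ := hx
  have hinc : ∀ h, h ∈ {h | S.Inc h x} ↔ h = e ∨ h = f := by
    refine fun h ↦ ⟨hxi h, ?_⟩
    rintro (rfl | rfl)
    exacts [he.inc_left, hf.inc_left]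
  refine ⟨fun h hh ↦ ?_, fun y hy ↦ ?_⟩
  · rcases hh with hh | hh
    · exact hM.1 hh.1
    · exact Inc.edge_mem hh.1
  obtain ⟨g, hg, hgy⟩ := hM.exists_inc hy
  by_cases hyx : y = x ∨ y = w
  · have hyi : ∀ h, S.Inc h y ↔ h = e ∨ h = f := by
      intro h
      constructor
      · rcases hyx with rfl | rfl
        exacts [hxi h, hwi h]
      · rcases hyx with rfl | rfl <;> rintro (rfl | rfl)
        exacts [he.inc_left, hf.inc_left, he.inc_right, hf.inc_right]
    have huniq : ∀ h ∈ M, S.Inc h y → h = g := fun h hh hhy ↦ hM.eq_of_inc hh hg hhy hgy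
    simp only [Set.mem_symmDiff, hinc, hyi] at huniq hgy ⊢
    rcases hgy with rfl | rfl
    · exact ⟨f, by grind, by grind⟩
    · exact ⟨e, by grind, by grind⟩
  · have hni : ∀ h, S.Inc h y → ¬ (h = e ∨ h = f) := by
      rintro h hh (rfl | rfl)
      · exact hyx (hh.eq_or_eq_of_isLink he)
      · exact hyx (hh.eq_or_eq_of_isLink hf)
    have huniq : ∀ h ∈ M, S.Inc h y → h = g := fun h hh hhy ↦ hM.eq_of_inc hh hg hhy hgy
    simp only [Set.mem_symmDiff, hinc]
    refine ⟨g, ⟨Or.inl ⟨hg, hni g hgy⟩, hgy⟩, ?_⟩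
    rintro h ⟨⟨hh, -⟩ | ⟨hh, -⟩, hhy⟩
    · exact huniq h hh hhy
    · exact (hni h hhy hh).elim

/-- For a fixed `M`, exchanging the parallel edges at `x` gives a matching `N` whose difference from
`M` consists of the edges at `x`. As an edge has two ends, `N` determines `x` up to two choices. -/
theorem ncard_multiEdgeVertices_le (hE : S.edgeSet.Finite)
    (hne : S.perfectMatchings.Nonempty) {n : ℕ} (hn : S.perfectMatchings.ncard ≤ n) :
    S.multiEdgeVertices.ncard ≤ n * 2 := by
  classical
  obtain ⟨M, hM⟩ := hne
  have hPM := finite_perfectMatchings hE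
  have := hPM.fintype
  have hsub : ∀ N : S.perfectMatchings, ∃ a b : Set α, a.Subsingleton ∧ b.Subsingleton ∧
      {x | (symmDiff M (N : Set β)).Nonempty ∧ ∀ h ∈ symmDiff M (N : Set β), S.Inc h x} ⊆ a ∪ b := by
    intro N
    by_cases h : ∃ h ∈ symmDiff M (N : Set β), h ∈ S.edgeSet
    · obtain ⟨h, hh, hhE⟩ := h
      obtain ⟨x, y, hxy⟩ := exists_isLink_of_mem_edgeSet hhE
      exact ⟨{x}, {y}, Set.subsingleton_singleton, Set.subsingleton_singleton,
        fun z hz ↦ (hz.2 h hh).eq_or_eq_of_isLink hxy⟩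
    · refine ⟨∅, ∅, Set.subsingleton_empty, Set.subsingleton_empty, ?_⟩
      rintro x ⟨⟨h', hh'⟩, hx⟩
      exact (h ⟨h', hh', (hx h' hh').edge_mem⟩).elim
  have hfin : ∀ N : S.perfectMatchings,
      {x | (symmDiff M (N : Set β)).Nonempty ∧ ∀ h ∈ symmDiff M (N : Set β), S.Inc h x}.Finite ∧
      {x | (symmDiff M (N : Set β)).Nonempty ∧
        ∀ h ∈ symmDiff M (N : Set β), S.Inc h x}.ncard ≤ 2 := by
    intro N
    obtain ⟨a, b, ha, hb, hab⟩ := hsub N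
    have hf := ha.finite.union hb.finite
    refine ⟨hf.subset hab, (Set.ncard_le_ncard hab hf).trans ((Set.ncard_union_le a b).trans ?_)⟩
    have h1 := (Set.ncard_le_one ha.finite).2 fun x hx y hy ↦ ha hx hy
    have h2 := (Set.ncard_le_one hb.finite).2 fun x hx y hy ↦ hb hx hy
    omega
  refine Set.ncard_le_mul_of_subset_iUnion (s := fun N : S.perfectMatchings ↦
    {x | (symmDiff M (N : Set β)).Nonempty ∧ ∀ h ∈ symmDiff M (N : Set β), S.Inc h x}) ?_
    (fun N ↦ (hfin N).1) (by rwa [← Nat.card_eq_fintype_card]) fun N ↦ (hfin N).2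
  intro x hx
  refine Set.mem_iUnion.2 ⟨⟨_, isPerfectMatching_symmDiff_of_mem_multiEdgeVertices hM hx⟩, ?_⟩
  simp only [symmDiff_symmDiff_cancel_left]
  obtain ⟨w, e, f, -, he, -⟩ := hx
  exact ⟨⟨e, he.inc_left⟩, fun h hh ↦ hh⟩

/-- In a tight graph without suppressible paths, a vertex of degree two lies next to a vertex of
larger degree or on a double edge that forms a component. -/
theorem mem_of_not_isSuppressiblePath [S.Loopless] (hS : S.IsTight k) (hk : 1 ≤ k)
    (hirr : ∀ u v w z e f g, ¬ S.IsSuppressiblePath u v w z e f g) {x : α}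
    (hx : x ∈ S.vertexSet) :
    x ∈ S.branchVertices ∪ {x | ∃ y ∈ S.branchVertices, S.Adj x y} ∪ S.multiEdgeVertices := by
  by_contra hcon
  simp only [Set.mem_union, not_or] at hcon
  obtain ⟨⟨hx3, hxadj⟩, hxm⟩ := hcon
  have hdeg : ∀ y ∉ S.branchVertices, ∀ a b, a ≠ b → S.Inc a y → S.Inc b y →
      ∀ h, S.Inc h y → h = a ∨ h = b := by
    intro y hy a b hab ha hb h hh
    by_contra! hc
    refine hy ⟨![a, b, h], ?_, ?_⟩
    · intro i j hij
      fin_cases i <;> fin_cases j <;> simp_all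
    · intro i
      fin_cases i
      exacts [ha, hb, hh]
  obtain ⟨M, hM⟩ : S.perfectMatchings.Nonempty := by
    rw [← Set.encard_pos]
    exact lt_of_lt_of_le (by exact_mod_cast hk) hS.isMatchable
  obtain ⟨e, -, w, hew⟩ := IsPerfectMatching.exists_inc hM hx
  have hw3 : w ∉ S.branchVertices := fun h ↦ hxadj ⟨w, h, e, hew⟩
  obtain ⟨f, hfe, u, hfu⟩ := hS.exists_ne_inc hew.inc_left
  obtain ⟨g, hge, z, hgz⟩ := hS.exists_ne_inc hew.inc_right
  have hxi := hdeg x hx3 e f hfe.symm hew.inc_left hfu.inc_left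
  have hwi := hdeg w hw3 e g hge.symm hew.inc_right hgz.inc_left
  by_cases hfg : f = g
  · subst hfg
    have hxw : S.IsLink f x w := by
      rcases hgz.inc_left.eq_or_eq_of_isLink hfu with h | h
      · exact (hew.ne h.symm).elim
      · rwa [h]
    exact hxm ⟨w, e, f, hfe.symm, hew, hxw, hxi, hwi⟩
  -- The case `u = z` is a triangle `u, x, w`: a perfect matching through `f` covers `u` and `x`, so
  -- neither `e` nor `g` is left to cover `w`.
  · refine hirr u x w z e f g ⟨hfu.symm, hew, hgz, hxi, hwi, hfe, hge, hfg, ?_⟩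
    rintro rfl
    obtain ⟨N, hN, hfN⟩ := hS.exists_mem hfu.edge_mem
    obtain ⟨h, hhN, hhw⟩ := hN.exists_inc hew.right_mem
    rcases hwi h hhw with rfl | rfl
    · exact hfe (hN.eq_of_inc hfN hhN hfu.inc_left hew.inc_left)
    · exact hfg (hN.eq_of_inc hfN hhN hfu.inc_right hgz.inc_right)

/-- A bound on the number of vertices and edges of the tight graphs without suppressible paths. -/
def sizeBound (k : ℕ) : ℕ :=
  let n := 2 * k
  let b := n ^ 3 * (5 * 3 ^ n)
  (n + 1) * (b + n * b + n * 2)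

theorem ncard_le_sizeBound (hfl : S.IsFiniteLoopless) (hS : S.IsTight k) (hk : 1 ≤ k)
    (hirr : ∀ u v w z e f g, ¬ S.IsSuppressiblePath u v w z e f g) :
    S.vertexSet.ncard ≤ sizeBound k ∧ S.edgeSet.ncard ≤ sizeBound k := by
  have := hfl.loopless
  have hV := hfl.finite_vertexSet
  have hE := hfl.finite_edgeSet
  rcases S.vertexSet.eq_empty_or_nonempty with h | hne
  · have hE0 : S.edgeSet = ∅ := by
      rw [Set.eq_empty_iff_forall_notMem]
      intro e he
      obtain ⟨x, y, hxy⟩ := exists_isLink_of_mem_edgeSet he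
      have := hxy.left_mem
      rw [h] at this
      exact this
    simp [h, hE0]
  have hn := hS.ncard_perfectMatchings_le hk hne
  have hPne : S.perfectMatchings.Nonempty := by
    rw [← Set.encard_pos]
    exact lt_of_lt_of_le (by exact_mod_cast hk) hS.isMatchable
  have hbfin : S.branchVertices.Finite := hV.subset fun x ⟨e, _, he⟩ ↦ (he 0).vertex_mem
  have hafin : {x | ∃ y ∈ S.branchVertices, S.Adj x y}.Finite :=
    hV.subset fun x ⟨y, _, h⟩ ↦ h.left_mem
  have hmfin : S.multiEdgeVertices.Finite :=
    hV.subset fun x ⟨w, e, f, _, he, _⟩ ↦ he.left_mem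
  have h1 := ncard_branchVertices_le hV hE hS hn
  have h2 := ncard_neighbours_le hE hS hn hbfin
  have h3 := ncard_multiEdgeVertices_le hE hPne hn
  have h4 := ncard_edgeSet_le hV hE hS hn
  have h5 : S.vertexSet.ncard ≤ (2 * k) ^ 3 * (5 * 3 ^ (2 * k)) +
      2 * k * ((2 * k) ^ 3 * (5 * 3 ^ (2 * k))) + 2 * k * 2 := by
    refine (Set.ncard_le_ncard (fun x hx ↦ mem_of_not_isSuppressiblePath hS hk hirr hx)
      ((hbfin.union hafin).union hmfin)).trans ?_
    refine (Set.ncard_union_le _ _).trans (add_le_add ((Set.ncard_union_le _ _).trans ?_) h3)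
    exact add_le_add h1 (h2.trans (Nat.mul_le_mul_left _ h1))
  simp only [sizeBound]
  generalize (2 * k) ^ 3 * (5 * 3 ^ (2 * k)) + 2 * k * ((2 * k) ^ 3 * (5 * 3 ^ (2 * k))) +
    2 * k * 2 = B at h5 ⊢
  exact ⟨h5.trans (Nat.le_mul_of_pos_left _ (by omega)),
    h4.trans ((Nat.mul_le_mul_left _ h5).trans (Nat.mul_le_mul_right _ (by omega)))⟩

end Graph

/-! ### The finite family and the theorem. -/

namespace Graph

section Relabel

variable {α β α' β' : Type*}

/-- The image of a graph under a map of the vertices and an injective map of the edges. -/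
def relabel (G : Graph α β) (f : α → α') {g : β → β'} (hg : Set.InjOn g G.edgeSet) : Graph α' β' where
  vertexSet := f '' G.vertexSet
  edgeSet := g '' G.edgeSet
  IsLink e' x' y' := ∃ e x y, G.IsLink e x y ∧ g e = e' ∧ f x = x' ∧ f y = y'
  isLink_symm _ _ := ⟨fun _ _ ⟨e, x, y, h, he, hx, hy⟩ ↦ ⟨e, y, x, h.symm, he, hy, hx⟩⟩
  eq_or_eq_of_isLink_of_isLink := by
    rintro _ _ _ _ _ ⟨e, x, y, h, rfl, rfl, rfl⟩ ⟨e', x', y', h', he, rfl, rfl⟩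
    obtain rfl := hg h'.edge_mem h.edge_mem he
    exact (h.left_eq_or_eq h').imp (congrArg f) (congrArg f)
  edge_mem_iff_exists_isLink e' := by
    constructor
    · rintro ⟨e, he, rfl⟩
      obtain ⟨x, y, h⟩ := exists_isLink_of_mem_edgeSet he
      exact ⟨f x, f y, e, x, y, h, rfl, rfl, rfl⟩
    · rintro ⟨_, _, e, x, y, h, rfl, -, -⟩
      exact ⟨e, h.edge_mem, rfl⟩
  left_mem_of_isLink := by
    rintro _ _ _ ⟨e, x, y, h, -, rfl, -⟩
    exact ⟨x, h.left_mem, rfl⟩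

/-- A graph is isomorphic to its relabelling. -/
noncomputable def relabelIso (G : Graph α β) {f : α → α'} {g : β → β'}
    (hf : Set.InjOn f G.vertexSet) (hg : Set.InjOn g G.edgeSet) :
    Isomorphism G (G.relabel f hg) :=
  Isomorphism.ofBijOn f g hf.bijOn_image hg.bijOn_image fun e he x hx y hy ↦ by
    constructor
    · exact fun h ↦ ⟨e, x, y, h, rfl, rfl, rfl⟩
    · rintro ⟨e', x', y', h, he', hx', hy'⟩
      rwa [hg h.edge_mem he he', hf h.left_mem hx hx', hf h.right_mem hy hy'] at h

theorem isFiniteLoopless_relabel {G : Graph α β} (hG : G.IsFiniteLoopless) {f : α → α'}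
    {g : β → β'} (hf : Set.InjOn f G.vertexSet) (hg : Set.InjOn g G.edgeSet) :
    (G.relabel f hg).IsFiniteLoopless where
  finite_vertexSet := hG.finite_vertexSet.image f
  finite_edgeSet := hG.finite_edgeSet.image g
  loopless := ⟨by
    rintro _ _ ⟨e, x, y, h, -, hx, hy⟩
    have := hG.loopless
    exact h.ne (hf h.left_mem h.right_mem (hx.trans hy.symm))⟩

theorem exists_injOn_nat_lt {γ : Type*} {s : Set γ} (hs : s.Finite) {B : ℕ} (hB : s.ncard ≤ B) :
    ∃ f : γ → ℕ, Set.InjOn f s ∧ ∀ x ∈ s, f x < B := by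
  classical
  have := hs.fintype
  let i := Fintype.equivFin s
  refine ⟨fun x ↦ if h : x ∈ s then i ⟨x, h⟩ else 0, fun x hx y hy h ↦ ?_, fun x hx ↦ ?_⟩
  · simp only [dif_pos hx, dif_pos hy] at h
    exact congrArg Subtype.val (i.injective (Fin.ext h))
  · simp only [dif_pos hx]
    refine (i ⟨x, hx⟩).2.trans_le (le_trans (le_of_eq ?_) hB)
    rw [← Nat.card_eq_fintype_card]
    rfl

theorem finite_setOf_vertexSet_subset_edgeSet_subset (s : Set α) (t : Set β) (hs : s.Finite)
    (ht : t.Finite) : {G : Graph α β | G.vertexSet ⊆ s ∧ G.edgeSet ⊆ t}.Finite := by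
  refine Set.Finite.of_finite_image (f := fun G : Graph α β ↦
    (G.vertexSet, {p : β × α × α | G.IsLink p.1 p.2.1 p.2.2}))
    ((hs.finite_subsets.prod (ht.prod (hs.prod hs)).finite_subsets).subset ?_) ?_
  · rintro _ ⟨G, ⟨h1, h2⟩, rfl⟩
    exact ⟨h1, fun p hp ↦ ⟨h2 (IsLink.edge_mem hp), h1 (IsLink.left_mem hp),
      h1 (IsLink.right_mem hp)⟩⟩
  · intro G _ G' _ h
    refine Graph.ext (congrArg Prod.fst h) fun e x y ↦ ?_
    exact Set.ext_iff.1 (congrArg Prod.snd h) (e, x, y)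

end Relabel

/-- The tight graphs of bounded size on initial segments of the natural numbers. -/
def boundedTightGraphs (k : ℕ) : Set (Graph ℕ ℕ) :=
  {H | (H.vertexSet ⊆ Set.Iio (sizeBound k) ∧ H.edgeSet ⊆ Set.Iio (sizeBound k)) ∧
    H.IsFiniteLoopless ∧ H.IsTight k}

/-- Every tight graph is an odd subdivision of one of bounded size. -/
theorem IsTight.exists_isOddSubdivision {α β : Type*} {k : ℕ} (hk : 1 ≤ k) (n : ℕ) :
    ∀ {S : Graph α β}, S.vertexSet.ncard = n → S.IsFiniteLoopless → S.IsTight k →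
      ∃ H ∈ boundedTightGraphs k, IsOddSubdivision H S := by
  induction n using Nat.strong_induction_on with
  | _ n ih =>
  intro S hn hfl hS
  have := hfl.loopless
  by_cases hirr : ∀ u v w z e f g, ¬ S.IsSuppressiblePath u v w z e f g
  · obtain ⟨hV, hE⟩ := ncard_le_sizeBound hfl hS hk hirr
    obtain ⟨f, hf, hfB⟩ := exists_injOn_nat_lt hfl.finite_vertexSet hV
    obtain ⟨g, hg, hgB⟩ := exists_injOn_nat_lt hfl.finite_edgeSet hE
    have hH := isFiniteLoopless_relabel hfl hf hg
    have := hH.loopless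
    obtain ⟨o⟩ := (S.relabelIso hf hg).symm.isOddSubdivision
    refine ⟨S.relabel f hg, ⟨⟨?_, ?_⟩, hH, (o.isTight_iff k).2 hS⟩, ⟨o⟩⟩
    · rintro _ ⟨x, hx, rfl⟩
      exact hfB x hx
    · rintro _ ⟨e, he, rfl⟩
      exact hgB e he
  · push Not at hirr
    obtain ⟨u, v, w, z, e, f, g, p⟩ := hirr
    have hfl' := p.isFiniteLoopless_suppress hfl
    have := hfl'.loopless
    have hlt : p.suppress.vertexSet.ncard < n := by
      rw [← hn]
      refine Set.ncard_lt_ncard ⟨Set.sdiff_subset, fun h ↦ ?_⟩ hfl.finite_vertexSet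
      exact (h p.link_mid.left_mem).2 (by simp)
    -- With trivial paths, this exhibits `S` as an odd subdivision of `p.suppress`, so tightness
    -- passes down.
    have hrefl : IsOddSubdivision p.suppress p.suppress :=
      (Isomorphism.ofBijOn id id (Set.bijOn_id _) (Set.bijOn_id _)
        fun _ _ _ _ _ _ ↦ Iff.rfl).isOddSubdivision
    obtain ⟨o⟩ := p.isOddSubdivision hrefl
    obtain ⟨H, hH, hHS⟩ := ih _ hlt rfl hfl' ((o.isTight_iff k).2 hS)
    exact ⟨H, hH, p.isOddSubdivision hHS⟩

theorem isFiniteLoopless_deleteIsolatedEdges {α β : Type*} {G : Graph α β}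
    (hG : G.IsFiniteLoopless) : G.deleteIsolatedEdges.IsFiniteLoopless where
  finite_vertexSet := hG.finite_vertexSet.subset (Set.sep_subset _ _)
  finite_edgeSet := hG.finite_edgeSet.subset Set.sdiff_subset
  loopless := ⟨fun e x h ↦ by
    have := hG.loopless
    exact h.1.ne rfl⟩

end Graph

theorem theorem1 (k : ℕ) (hk : 1 ≤ k) :
    ∃ 𝔊 : Set (Graph ℕ ℕ), 𝔊.Finite ∧ (∀ H ∈ 𝔊, H.IsFiniteLoopless) ∧
      ∀ {α : Type*} {β : Type*} (G : Graph α β), G.IsFiniteLoopless →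
        (G.IsMinimallyMatchable k ↔ ∃ H ∈ 𝔊, Graph.IsOddSubdivisionWithCopiesK2 H G) := by
  refine ⟨Graph.boundedTightGraphs k,
    (Graph.finite_setOf_vertexSet_subset_edgeSet_subset _ _ (Set.finite_Iio _)
      (Set.finite_Iio _)).subset fun H hH ↦ hH.1, fun H hH ↦ hH.2.1, fun G hG ↦ ⟨fun h ↦ ?_, ?_⟩⟩
  · obtain ⟨q, ⟨φ⟩⟩ := G.exists_isomorphism_disjointUnion_copiesK2 hG
    have hS := ((φ.isMinimallyMatchable_iff k).1 h).isTight_of_disjointUnion_copiesK2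
      G.exists_adjacent_of_mem_deleteIsolatedEdges
    obtain ⟨H, hH, hHS⟩ := Graph.IsTight.exists_isOddSubdivision hk _ rfl
      (Graph.isFiniteLoopless_deleteIsolatedEdges hG) hS
    exact ⟨H, hH, _, _, _, q, hHS, ⟨φ⟩⟩
  · rintro ⟨H, hH, γ, δ, S, q, ⟨o⟩, ⟨φ⟩⟩
    have := hH.2.1.loopless
    exact (φ.isMinimallyMatchable_iff k).2
      (Graph.isMinimallyMatchable_disjointUnion_copiesK2 hk ((o.isTight_iff k).1 hH.2.2))
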